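/- For integers $m>0$ and $p\ge 0$, the broom $B_{m,p}$ is the rooted tree consisting of a path of length $p$ that starts at the root, together with $m$ pendant vertices attached to the last vertex of the path (for $p=0$, to the root). For rooted trees $S$ and $T$, let $S\cdot T$ be the rooted tree obtained from their disjoint union by identifying the two roots. For a finite rooted tree $T$ with root $r$, let $C(T,r)$ be the poset of all connected, vertex-induced subgraphs of $T$ that contain $r$, ordered by inclusion; its rank sequence $(r_i)_{i\ge 1}$ has as $r_i$ the number of elements of rank $i$, that is, the number of such subgraphs with exactly $i$ vertices. The poset is called rank unimodal if this sequence is unimodal, i.e. weakly increasing up to some index and weakly decreasing from there on. **Theorem.** Let $b_i$ be the number of rooted trees with $i$ vertices, up to isomorphism of rooted trees, that are of the form $T=B_{m,p}\cdot B_{n,q}$ for some integers $m,n>0$ and $p,q\ge 0$ and whose poset $C(T,r)$ is not rank unimodal. Then $b_1=b_2=\cdots=b_9=0$, and for every integer $k\ge 0$ $$b_{2k+10}=2\left(\sum_{i=0}^{k}\left\lfloor\frac{i(i+4)}{4}\right\rfloor\right)-\left\lfloor\frac{k^2}{4}\right\rfloor,$$ $$b_{2k+11}=2\left(\sum_{i=0}^{k}\left\lfloor\frac{i(i+4)}{4}\right\rfloor\right)+\left\lfloor\frac{(k+1)(k+5)}{4}\right\rfloor-\left\lfloor\frac{k^2}{4}\right\rfloor.$$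 -/

import Mathlib

/-- A (finite or infinite) simple graph with a distinguished vertex, the root. A rooted tree is
regarded as such a graph; the orientation of its edges (away from the root) is determined by the
root. -/
structure RootedGraph where
  /-- The vertices. -/
  V : Type
  /-- The underlying graph. -/
  graph : SimpleGraph V
  /-- The root vertex. -/
  root : V

namespace RootedGraph

/-- Isomorphism of rooted graphs: a graph isomorphism that maps the root to the root. -/
def Isomorphic (S T : RootedGraph) : Prop :=
  ∃ f : S.graph ≃g T.graph, f S.root = T.root

/-- Isomorphism is an equivalence relation. -/
instance isoSetoid : Setoid RootedGraph where
  r := Isomorphic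
  iseqv :=
    { refl := fun _ => ⟨SimpleGraph.Iso.refl, rfl⟩
      symm := fun {S T} h => by
        obtain ⟨f, hf⟩ := h
        refine ⟨f.symm, ?_⟩
        rw [← hf]
        exact f.symm_apply_apply S.root
      trans := fun {S T U} h h' => by
        obtain ⟨f, hf⟩ := h
        obtain ⟨g, hg⟩ := h'
        refine ⟨f.trans g, ?_⟩
        rw [← hg, ← hf]
        rfl }

/-- Isomorphism classes of rooted graphs. -/
abbrev IsoClass : Type 1 := Quotient isoSetoid

/-- The broom graph `B_{m,k}`: vertices `x_0, …, x_{m+k}` with root `x_0`; the handle is the path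
`x_0, x_1, …, x_k` of length `k`, and `x_{k+1}, …, x_{k+m}` are pendant vertices attached
to `x_k`. -/
def broom (m k : ℕ) : RootedGraph where
  V := Fin (m + k + 1)
  graph := SimpleGraph.fromRel fun a b =>
    (b.val ≤ k ∧ b.val = a.val + 1) ∨ (k < b.val ∧ a.val = k)
  root := 0

/-- Adjacency in the merge of two rooted graphs, see `merge`. -/
def mergeAdj (S T : RootedGraph) :
    S.V ⊕ {w : T.V // w ≠ T.root} → S.V ⊕ {w : T.V // w ≠ T.root} → Prop
  | .inl a, .inl b => S.graph.Adj a b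
  | .inr a, .inr b => T.graph.Adj a.1 b.1
  | .inl a, .inr b => a = S.root ∧ T.graph.Adj T.root b.1
  | .inr a, .inl b => b = S.root ∧ T.graph.Adj T.root a.1

/-- The merge `S · T`: the disjoint union of `S` and `T` with the two roots identified. The common
root is represented by the root of `S`, so that the vertices are those of `S` together with the
vertices of `T` other than its root. -/
def merge (S T : RootedGraph) : RootedGraph where
  V := S.V ⊕ {w : T.V // w ≠ T.root}
  graph :=
    { Adj := mergeAdj S T
      symm := ⟨by
        rintro (a | a) (b | b) h
        · exact SimpleGraph.Adj.symm (G := S.graph) h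
        · exact h
        · exact h
        · exact SimpleGraph.Adj.symm (G := T.graph) h⟩
      loopless := ⟨by
        rintro (a | a) h
        · exact S.graph.loopless.irrefl a h
        · exact T.graph.loopless.irrefl a.1 h⟩ }
  root := .inl S.root

/-- The poset `C(T, r)` of the connected, vertex-induced subgraphs of `T` that contain the root,
ordered by inclusion. A vertex-induced subgraph is given by its set of vertices. -/
abbrev C (T : RootedGraph) : Type :=
  {S : Set T.V // T.root ∈ S ∧ (T.graph.induce S).Connected}

end RootedGraph

/-- A sequence is unimodal if it increases weakly up to some index `k` and decreases weakly
from `k` on. -/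
def Unimodal (s : ℕ → ℕ) : Prop :=
  ∃ k, MonotoneOn s (Set.Iic k) ∧ AntitoneOn s (Set.Ici k)

/-- The rank sequence (Whitney numbers) of a finite graded poset: the `i`-th term is the number of
elements of rank `i`, where the rank of `x` is the length of a longest chain that ends in `x`. So
minimal elements have rank `0`, and a subgraph with `i + 1` vertices has rank `i` in `C(T, r)`;
numbering the ranks from `1` instead shifts the sequence and does not affect its unimodality. -/
noncomputable def rankSequence (P : Type) [PartialOrder P] (i : ℕ) : ℕ :=
  Set.ncard {x : P | Order.height x = i}

/-- A poset is rank unimodal if its rank sequence is unimodal. -/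
def RankUnimodal (P : Type) [PartialOrder P] : Prop :=
  Unimodal (rankSequence P)

open RootedGraph in
/-- The isomorphism classes of the rooted trees `T = B_{m,p} · B_{n,q}` (`m, n > 0`, `p, q ≥ 0`)
with `i` vertices for which `C(T, r)` is not rank unimodal. -/
def nonUnimodalTrees (i : ℕ) : Set IsoClass :=
  {c | ∃ (T : RootedGraph) (m n p q : ℕ), 0 < m ∧ 0 < n ∧ T = merge (broom m p) (broom n q) ∧
    Nat.card T.V = i ∧ ¬ RankUnimodal T.C ∧ c = ⟦T⟧}

/-- The number `b_i` of such trees up to isomorphism. -/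
noncomputable def nonUnimodalCount (i : ℕ) : ℕ :=
  (nonUnimodalTrees i).ncard

/-! A connected subgraph containing the root is a vertex set closed under taking parents. In a merge
such a set is a pair of closed sets, one from each factor, so the rank polynomial (shifted down by
one degree) is a product of two broom polynomials `1 + X + ⋯ + X^(p-1) + X^p (1 + X)^m`. Multiplying
by `1 - X` turns unimodality into a statement about signs: after a negative coefficient no positive
one may follow.

For `m, n > 0` this fails exactly when `BadBrooms` holds. In that case the coefficient just past
both `p + m` and `q + n` is `-1`, while the one at `p + q + 2` is at least `m * n - (m + n) > 0`: a
drop followed by a rise (`not_unimodal_of_badBrooms`). If `q < m` (or, symmetrically, `p < n`),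
nothing drops below degree `p + q`. From there on the coefficients are ballot numbers corrected by
binomials, and comparing ratios of consecutive terms shows that once negative they stay nonpositive
(`tailDiff_nonpos_of_neg`). The cases left, a single pendant vertex or `m = n = 2`, have nonpositive
coefficients beyond `p + q`.

In the bad case both handles have positive length and both brooms have at least two pendant
vertices. The branching vertices other than the root then recover the unordered pair `{(p, m), (q,
n)}`, and isomorphism classes correspond to unordered pairs of brooms
(`isomorphic_merge_broom_iff`). What remains is to count lattice points and evaluate the sum. -/

open Polynomial Finset

/-! ### Ballot numbers compared with binomial coefficients -/

/-- The ballot number `C(M, j) - C(M, j - 1)`, a coefficient of `(1 - X) * (1 + X) ^ M`. -/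
def ballot (M : ℕ) : ℕ → ℤ
  | 0 => 1
  | j + 1 => (M.choose (j + 1) : ℤ) - M.choose j

theorem ballot_succ_succ (M j : ℕ) : ballot (M + 1) (j + 1) = ballot M (j + 1) + ballot M j := by
  cases j with
  | zero => simp [ballot]
  | succ j => simp only [ballot, Nat.choose_succ_succ M]; push_cast; ring

theorem choose_succ_mul_int (M j : ℕ) :
    (M.choose (j + 1) : ℤ) * (j + 1) = M.choose j * (M - j) := by
  rcases le_or_gt j M with hj | hj
  · have := Nat.choose_succ_right_eq M j
    zify [hj] at this
    exact this
  · simp [Nat.choose_eq_zero_of_lt hj, Nat.choose_eq_zero_of_lt (Nat.lt_succ_of_lt hj)]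

theorem ballot_mul (M j : ℕ) :
    ballot M j * (M + 1 - j) = M.choose j * (M + 1 - 2 * j) := by
  cases j with
  | zero => simp [ballot]
  | succ j =>
    have h := choose_succ_mul_int M j
    simp only [ballot]
    push_cast
    linear_combination h

theorem ballot_nonneg {M j : ℕ} (h : 2 * j ≤ M + 1) : 0 ≤ ballot M j := by
  cases j with
  | zero => simp [ballot]
  | succ j =>
    have := Nat.choose_le_succ_of_lt_half_left (n := M) (r := j)
    have h1 : M.choose j ≤ M.choose (j + 1) := by
      rcases Nat.lt_or_ge j (M / 2) with h2 | h2
      · exact this h2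
      · have : M = j + (j + 1) := by omega
        rw [this]
        exact (Nat.choose_symm_add (a := j) (b := j + 1)).le
    simp only [ballot]
    omega

theorem choose_anti {n a b : ℕ} (hab : a ≤ b) (h : n ≤ 2 * a + 1) : n.choose b ≤ n.choose a := by
  induction b, hab using Nat.le_induction with
  | base => exact le_rfl
  | succ b hb ih =>
    refine le_trans ?_ ih
    have h1 := Nat.choose_succ_right_eq n b
    have h2 : n.choose b * (n - b) ≤ n.choose b * (b + 1) := Nat.mul_le_mul_left _ (by omega)
    exact Nat.le_of_mul_le_mul_right (h1.le.trans h2) (Nat.succ_pos b)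

theorem ballot_nonpos {M j : ℕ} (h : M < 2 * j) : ballot M j ≤ 0 := by
  cases j with
  | zero => omega
  | succ j =>
    have := choose_anti (n := M) (Nat.le_add_right j 1) (by omega)
    simp only [ballot]
    omega

/-- The ratio of consecutive ballot numbers, with denominators cleared. The proof cancels `M - j`,
so `j = M` is treated apart. -/
theorem ballot_succ_mul {M j : ℕ} (h : j ≤ M) :
    ballot M (j + 1) * ((j + 1) * (M + 1 - 2 * j)) = ballot M j * ((M + 1 - j) * (M - 1 - 2 * j)) := by
  have h1 := ballot_mul M j
  have h2 := ballot_mul M (j + 1)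
  have h3 := choose_succ_mul_int M j
  push_cast at h2
  rcases h.eq_or_lt with rfl | h4
  · simp only [ballot]
    cases j with
    | zero => simp
    | succ k =>
      simp only [Nat.choose_self, Nat.choose_succ_self, Nat.choose_succ_self_right]
      push_cast
      ring
  · have h5 : ((M : ℤ) - j) ≠ 0 := by omega
    apply mul_right_cancel₀ h5
    linear_combination (j + 1 : ℤ) * (M + 1 - 2 * j) * h2 - (M - j : ℤ) * (M - 1 - 2 * j) * h1
      + (M + 1 - 2 * j : ℤ) * (M - 1 - 2 * j) * h3

theorem choose_le_ballot {m n j : ℕ} (hn : j ≤ n) (hm : j ≤ m + 1) :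
    (m.choose j : ℤ) ≤ ballot (m + n) j := by
  induction m generalizing j with
  | zero =>
    interval_cases j
    · simp [ballot]
    · simpa using ballot_nonneg (M := 0 + n) (j := 1) (by omega)
  | succ m ih =>
    cases j with
    | zero => simp [ballot]
    | succ j =>
      rcases Nat.lt_or_ge j (m + 1) with h | h
      · have h1 := ih hn (by omega)
        have h2 := ih (j := j) (by omega) (by omega)
        rw [show m + 1 + n = m + n + 1 by ring, ballot_succ_succ, Nat.choose_succ_succ]
        push_cast
        linarith
      · rw [Nat.choose_eq_zero_of_lt (by omega)]
        exact ballot_nonneg (by omega)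

/-- Both sides obey Pascal's rule, and `choose_le_ballot` bounds the increment, so induction reduces
the claim to `m = n = j`. There the ballot number is the Catalan number, which is at least 2 once `j
≥ 2`. -/
theorem choose_add_choose_le_ballot {m n j : ℕ} (hj : 2 ≤ j) (hm : j ≤ m) (hn : j ≤ n) :
    (m.choose j + n.choose j : ℤ) ≤ ballot (m + n) j := by
  obtain ⟨j, rfl⟩ : ∃ i, j = i + 1 := ⟨j - 1, by omega⟩
  induction m, hm using Nat.le_induction with
  | base =>
    induction n, hn using Nat.le_induction with
    | base =>
      have h1 := ballot_mul (j + 1 + (j + 1)) (j + 1)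
      have h2 : (2 * (j + 1)).choose (j + 1) = (j + 1 + (j + 1)).choose (j + 1) := by rw [two_mul]
      have h3 : 4 ^ (j + 1) ≤ 2 * (j + 1) * Nat.centralBinom (j + 1) :=
        Nat.four_pow_le_two_mul_self_mul_centralBinom _ (by omega)
      have h4 : 2 * (j + 2) ≤ Nat.centralBinom (j + 1) := by
        clear h1 h2 h3
        obtain ⟨i, rfl⟩ : ∃ i, j = i + 1 := ⟨j - 1, by omega⟩
        clear hj
        induction i with
        | zero => decide
        | succ i ih =>
          have := Nat.succ_mul_centralBinom_succ (i + 1 + 1)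
          nlinarith
      rw [Nat.centralBinom, h2] at h4
      simp only [Nat.choose_self]
      push_cast at h1 h4 ⊢
      zify at h4
      nlinarith
    | succ n hn ih =>
      rw [← add_assoc, ballot_succ_succ, Nat.choose_succ_succ n, Nat.choose_self] at *
      have := choose_le_ballot (m := n) (n := j + 1) (j := j) (by omega) (by omega)
      rw [add_comm n] at this
      push_cast at *
      linarith
  | succ m hm ih =>
    rw [show m + 1 + n = m + n + 1 by ring, ballot_succ_succ, Nat.choose_succ_succ]
    have := choose_le_ballot (m := m) (n := n) (j := j) (by omega) (by omega)
    push_cast at *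
    linarith

/-- Cross-multiplying the ratios of consecutive terms leaves the difference `(s - 1) * (g + s + 1) -
2 * j * s`. Hence the quotient of the ballot number by `g.choose j` starts at 1 and does not
decrease as long as this difference is nonnegative. -/
theorem choose_le_ballot_of_small {g s j : ℕ} (hs : 0 < s) (hsg : s ≤ g)
    (h : 2 * (j : ℤ) * s ≤ (s - 1) * (g + s + 1)) : (g.choose j : ℤ) ≤ ballot (g + s) j := by
  induction j with
  | zero => simp [ballot]
  | succ j ih =>
    push_cast at h
    have hs' : (0 : ℤ) < s := by exact_mod_cast hs
    have ih := ih (by nlinarith)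
    have hlt : 2 * (j : ℤ) + 1 < g + s := by nlinarith
    have hr := ballot_succ_mul (M := g + s) (j := j) (by omega)
    have hc := choose_succ_mul_int g j
    push_cast at hr
    have hT : (0 : ℤ) ≤ ballot (g + s) j := ballot_nonneg (by omega)
    have h1 : ballot (g + s) j * ((g - j) * (g + s + 1 - 2 * j)) ≤
        ballot (g + s) j * ((g + s + 1 - j) * (g + s - 1 - 2 * j)) :=
      mul_le_mul_of_nonneg_left (by linarith) hT
    have h2 : (g.choose j : ℤ) * ((g - j) * (g + s + 1 - 2 * j)) ≤
        ballot (g + s) j * ((g - j) * (g + s + 1 - 2 * j)) :=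
      mul_le_mul_of_nonneg_right ih (mul_nonneg (by omega) (by omega))
    have h3 : (0 : ℤ) < (j + 1) * (g + s + 1 - 2 * j) := mul_pos (by omega) (by omega)
    refine le_of_mul_le_mul_right ?_ h3
    linear_combination h1 + h2 - hr + (g + s + 1 - 2 * j : ℤ) * hc

/-- The hypothesis forces `j` past the threshold of `choose_le_ballot_of_small`. From there the
ballot numbers grow by at most the factor `(g - j) / (j + 1)` of `g.choose j`, and the subtracted
binomial grows by no larger a factor, so the strict inequality persists. -/
theorem ballot_lt_choose_sub_choose {g s e j : ℕ} (hs : 0 < s) (hsj : s < j) (hj : 2 * j ≤ g + s)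
    (h : ballot (g + s) j < g.choose j - g.choose (j + e)) :
    ballot (g + s) (j + 1) < g.choose (j + 1) - g.choose (j + 1 + e) := by
  have hlt : (s - 1 : ℤ) * (g + s + 1) < 2 * (j : ℤ) * s := by
    by_contra! h'
    have := choose_le_ballot_of_small hs (by omega) h'
    omega
  have hr := ballot_succ_mul (M := g + s) (j := j) (by omega)
  have hc := choose_succ_mul_int g j
  have hc' := choose_succ_mul_int g (j + e)
  push_cast at hr hc'
  have hT : (0 : ℤ) ≤ ballot (g + s) j := ballot_nonneg (by omega)
  have h1 : ballot (g + s) j * ((g + s + 1 - j) * (g + s - 1 - 2 * j)) ≤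
      ballot (g + s) j * ((g - j) * (g + s + 1 - 2 * j)) :=
    mul_le_mul_of_nonneg_left (by linarith) hT
  have h2 : ballot (g + s) (j + 1) * (j + 1) ≤ ballot (g + s) j * (g - j) := by
    have h3 : (0 : ℤ) < g + s + 1 - 2 * j := by omega
    refine le_of_mul_le_mul_right ?_ h3
    linear_combination h1 + hr
  have h4 : ballot (g + s) j * (g - j) < (g.choose j - g.choose (j + e)) * (g - j) :=
    mul_lt_mul_of_pos_right h (by omega)
  have h5 : (0 : ℤ) ≤ g.choose (j + e + 1) * e := by positivity
  have h6 : (0 : ℤ) ≤ g.choose (j + e) * e := by positivity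
  rw [add_right_comm j 1 e]
  have h7 : (0 : ℤ) < j + 1 := by omega
  refine lt_of_mul_lt_mul_right ?_ h7.le
  linear_combination h2 + h4 + h5 + h6 - hc + hc'

/-! ### Signs of the differences from degree `p + q` on -/

/-- The difference of consecutive coefficients of the rank polynomial of `B_{m,p} · B_{n,q}` in
degree `p + q + j`. -/
def tailDiff (m n p q j : ℕ) : ℤ :=
  ballot (m + n) j - m.choose j + m.choose (j + q) - n.choose j + n.choose (j + p)

theorem tailDiff_comm (m n p q j : ℕ) : tailDiff m n p q j = tailDiff n m q p j := by
  simp only [tailDiff, add_comm m n]; ring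

theorem tailDiff_nonpos_of_lt {m n p q j : ℕ} (h : m + n < 2 * j) :
    tailDiff m n p q j ≤ 0 := by
  wlog hmn : n ≤ m generalizing m n p q
  · rw [tailDiff_comm]; exact this (by omega) (by omega)
  have h1 := ballot_nonpos h
  have h2 := choose_anti (n := m) (a := j) (b := j + q) (by omega) (by omega)
  have h3 : n.choose (j + p) ≤ n.choose j := by
    exact choose_anti (by omega) (by omega)
  simp only [tailDiff]; omega

theorem tailDiff_nonneg_of_le {m n p q j : ℕ} (hq : q < m) (hm : j ≤ max 1 m)
    -- For `j ≤ 1` the terms other than the two shifted binomials add up to `-1`, and `m.choose (j +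
    -- q)`, positive because `q < m`, makes up for it.
    (hn : j ≤ max 1 n) : 0 ≤ tailDiff m n p q j := by
  rcases Nat.lt_or_ge j 2 with h | h
  · interval_cases j
    · have : 0 < m.choose (0 + q) := Nat.choose_pos (by omega)
      simp only [tailDiff, ballot, Nat.choose_zero_right]
      push_cast
      omega
    · have : 0 < m.choose (1 + q) := Nat.choose_pos (by omega)
      simp only [tailDiff, ballot, Nat.choose_zero_right, zero_add, Nat.choose_one_right]
      push_cast
      omega
  · have := choose_add_choose_le_ballot (m := m) (n := n) h (by omega) (by omega)
    simp only [tailDiff]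
    omega

/-- A negative value forces `j` to exceed `m` or `n`. The binomials of that broom vanish, and the
rest is the situation of `ballot_lt_choose_sub_choose`. -/
theorem tailDiff_succ_neg {m n p q j : ℕ} (hm0 : 0 < m) (hn0 : 0 < n) (hq : q < m)
    (hj : 2 * j ≤ m + n) (h : tailDiff m n p q j < 0) : tailDiff m n p q (j + 1) < 0 := by
  have hmn : m < j ∨ n < j := by
    by_contra! h'
    have := tailDiff_nonneg_of_le (p := p) (n := n) (j := j) hq (by omega) (by omega)
    omega
  rcases hmn with hmj | hnj
  · have hz (i : ℕ) : m.choose (j + i) = 0 := Nat.choose_eq_zero_of_lt (by omega)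
    have := ballot_lt_choose_sub_choose (g := n) (e := p) hm0 hmj (by omega)
      (by simp only [tailDiff, add_comm m n, hz] at h
          rw [show m.choose j = 0 from hz 0] at h
          push_cast at h; linarith)
    simp only [tailDiff, add_comm m n, hz, add_assoc] at *
    push_cast; linarith
  · have hz (i : ℕ) : n.choose (j + i) = 0 := Nat.choose_eq_zero_of_lt (by omega)
    have := ballot_lt_choose_sub_choose (g := m) (e := q) hn0 hnj (by omega)
      (by simp only [tailDiff, hz] at h
          rw [show n.choose j = 0 from hz 0] at h
          push_cast at h; linarith)
    simp only [tailDiff, hz, add_assoc] at *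
    push_cast; linarith

theorem tailDiff_nonpos_of_neg {m n p q i j : ℕ} (hm0 : 0 < m) (hn0 : 0 < n) (hq : q < m)
    (hij : i ≤ j) (h : tailDiff m n p q i < 0) : tailDiff m n p q j ≤ 0 := by
  rcases Nat.lt_or_ge (m + n) (2 * j) with hj | hj
  · exact tailDiff_nonpos_of_lt hj
  · suffices tailDiff m n p q j < 0 from this.le
    induction j, hij using Nat.le_induction with
    | base => exact h
    | succ j hij ih => exact tailDiff_succ_neg hm0 hn0 hq (by omega) (ih (by omega))

theorem tailDiff_zero_nonpos {m n p q : ℕ} (hp : n ≤ p) (hq : m < q) :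
    tailDiff m n p q 0 ≤ 0 := by
  have h1 : m.choose (0 + q) = 0 := Nat.choose_eq_zero_of_lt (by omega)
  have h2 : n.choose (0 + p) ≤ n.choose n := choose_anti (by omega) (by omega)
  simp only [tailDiff, ballot, Nat.choose_zero_right, Nat.choose_self, h1] at *
  omega

theorem tailDiff_one_nonpos {n p q j : ℕ} (hp : n ≤ p) (hq : 1 ≤ q) :
    tailDiff 1 n p q (j + 1) ≤ 0 := by
  have h1 : Nat.choose 1 (j + 1 + q) = 0 := Nat.choose_eq_zero_of_lt (by omega)
  have h2 : n.choose (j + 1 + p) = 0 := Nat.choose_eq_zero_of_lt (by omega)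
  simp only [tailDiff, ballot, h1, h2]
  rcases j with _ | j
  · simp
  · simp only [add_comm 1 n, Nat.choose_succ_succ n]
    push_cast
    have : (0 : ℤ) ≤ Nat.choose 1 (j + 1 + 1) := by positivity
    linarith [(n.choose j).cast_nonneg (α := ℤ)]

theorem tailDiff_two_two_nonpos {p q j : ℕ} (hp : 2 ≤ p) (hq : 2 ≤ q) :
    tailDiff 2 2 p q (j + 1) ≤ 0 := by
  rcases Nat.lt_or_ge 4 (2 * (j + 1)) with h | h
  · exact tailDiff_nonpos_of_lt h
  · have h1 (e : ℕ) (he : 2 ≤ e) : Nat.choose 2 (j + 1 + e) = 0 :=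
      Nat.choose_eq_zero_of_lt (by omega)
    have hj : j ≤ 1 := by omega
    simp only [tailDiff, h1 p hp, h1 q hq]
    interval_cases j <;> simp [ballot, Nat.choose]

/-- This is the late rise: without the shifted binomials the value is `m * n - (m + n) = (m - 1) *
(n - 1) - 1`, which vanishes for `m = n = 2`. -/
theorem tailDiff_two_pos {m n p q : ℕ} (hm : 2 ≤ m) (hn : 2 ≤ n) (hmn : 5 ≤ m + n) :
    0 < tailDiff m n p q 2 := by
  have h (k : ℕ) : (k.choose 2 : ℤ) * 2 = k * (k - 1) := by
    simpa using choose_succ_mul_int k 1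
  have h1 := h m
  have h2 := h n
  have h3 := h (m + n)
  simp only [tailDiff, ballot, Nat.choose_one_right, one_add_one_eq_two]
  push_cast at *
  zify at hm hn hmn
  have h4 : (m + n : ℤ) < m * n := by nlinarith
  nlinarith [(m.choose (2 + q)).cast_nonneg (α := ℤ), (n.choose (2 + p)).cast_nonneg (α := ℤ)]

/-! ### Coefficients of `1 - X` times the rank polynomial -/

/-- The rank generating polynomial of the broom `B_{m,p}`, shifted down by one degree. -/
noncomputable def broomPoly (m p : ℕ) : ℤ[X] := ∑ i ∈ range p, X ^ i + X ^ p * (1 + X) ^ m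

theorem one_sub_X_mul_broomPoly_mul (m p n q : ℕ) :
    (1 - X) * (broomPoly m p * broomPoly n q) =
      ∑ i ∈ range p, X ^ i - X ^ q * ∑ i ∈ range p, X ^ i + X ^ p * (1 + X) ^ m
        + X ^ q * (1 + X) ^ n
        + X ^ (p + q) * ((1 - X) * (1 + X) ^ (m + n) - (1 + X) ^ m - (1 + X) ^ n) := by
  have hp := mul_neg_geom_sum (X : ℤ[X]) p
  have hq := mul_neg_geom_sum (X : ℤ[X]) q
  simp only [broomPoly]
  linear_combination (∑ i ∈ range p, X ^ i + X ^ p * (1 + X) ^ m) * hq + X ^ q * (1 + X) ^ n * hp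

theorem coeff_one_sub_X_mul (f : ℤ[X]) (i : ℕ) :
    ((1 - X) * f).coeff (i + 1) = f.coeff (i + 1) - f.coeff i := by
  rw [sub_mul, one_mul, coeff_sub, coeff_X_mul]

theorem coeff_sum_X_pow (p i : ℕ) :
    (∑ j ∈ range p, (X : ℤ[X]) ^ j).coeff i = if i < p then 1 else 0 := by
  simp [coeff_X_pow]

theorem coeff_one_sub_X_mul_one_add_X_pow (M j : ℕ) :
    ((1 - X : ℤ[X]) * (1 + X) ^ M).coeff j = ballot M j := by
  cases j with
  | zero => simp [ballot, coeff_zero_eq_eval_zero]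
  | succ j => rw [coeff_one_sub_X_mul]; simp [ballot, coeff_one_add_X_pow]

theorem coeff_zero_broomPoly (m p : ℕ) : (broomPoly m p).coeff 0 = 1 := by
  rw [broomPoly, coeff_add, coeff_sum_X_pow, coeff_X_pow_mul']
  rcases p.eq_zero_or_pos with rfl | hp
  · simp [coeff_zero_eq_eval_zero]
  · simp [hp, hp.ne']

theorem coeff_diff_of_lt {m n p q i : ℕ} (h : i < p + q) :
    ((1 - X) * (broomPoly m p * broomPoly n q)).coeff i =
      (if i < p then 1 else (m.choose (i - p) : ℤ)) +
        (if q ≤ i then (n.choose (i - q) : ℤ) - 1 else 0) := by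
  rw [one_sub_X_mul_broomPoly_mul]
  simp only [coeff_add, coeff_sub, coeff_X_pow_mul', coeff_one_add_X_pow, coeff_sum_X_pow]
  split_ifs <;> omega

theorem coeff_diff_add (m n p q j : ℕ) :
    ((1 - X) * (broomPoly m p * broomPoly n q)).coeff (p + q + j) = tailDiff m n p q j := by
  rw [one_sub_X_mul_broomPoly_mul]
  simp only [coeff_add, coeff_sub, coeff_X_pow_mul',
    coeff_sum_X_pow, coeff_one_sub_X_mul_one_add_X_pow, coeff_one_add_X_pow]
  rw [if_neg (by omega), if_pos (by omega), if_neg (by omega), if_pos (by omega),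
    if_pos (by omega), if_pos (by omega), show p + q + j - p = j + q by omega,
    show p + q + j - q = j + p by omega, Nat.add_sub_cancel_left, tailDiff]
  simp
  ring

theorem coeff_diff_nonneg {m n p q i : ℕ} (h : i < p + q) (hi : i ≤ p + m ∨ i ≤ q + n) :
    0 ≤ ((1 - X) * (broomPoly m p * broomPoly n q)).coeff i := by
  rw [coeff_diff_of_lt h]
  by_cases hp : i < p <;> by_cases hq : q ≤ i <;> simp only [hp, hq, if_true, if_false]
  · omega
  · omega
  · rcases hi with hi | hi
    · have : 0 < m.choose (i - p) := Nat.choose_pos (by omega)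
      omega
    · have : 0 < n.choose (i - q) := Nat.choose_pos (by omega)
      omega
  · omega

/-- Past `p + m` and `q + n` every binomial contribution has died out. Below `p + q` the `-1` comes
from the term `-X ^ q * ∑ X ^ i`; at `p + q` and `p + q + 1` it comes from the tail formula. -/
theorem coeff_diff_eq_neg_one {m n p q i : ℕ} (hi : p + m < i) (hi' : q + n < i)
    (h : i ≤ p + q + 1) (h' : i = p + q → m < q ∧ n < p) :
    ((1 - X) * (broomPoly m p * broomPoly n q)).coeff i = -1 := by
  rcases Nat.lt_or_ge i (p + q) with hlt | hge
  · rw [coeff_diff_of_lt hlt, if_neg (by omega), if_pos (by omega),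
      Nat.choose_eq_zero_of_lt (by omega), Nat.choose_eq_zero_of_lt (by omega)]
    simp
  · obtain ⟨j, rfl⟩ := Nat.exists_eq_add_of_le hge
    rw [coeff_diff_add]
    have h1 : m.choose (j + q) = 0 := Nat.choose_eq_zero_of_lt (by omega)
    have h2 : n.choose (j + p) = 0 := Nat.choose_eq_zero_of_lt (by omega)
    have hj : j ≤ 1 := by omega
    simp only [tailDiff, h1, h2]
    interval_cases j
    · simp [ballot]
    · simp [ballot]
      ring

/-! ### The criterion for unimodality -/

/-- The peak is the index of the first descent; `h0` guarantees that there is one. -/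
theorem unimodal_of_forall {s : ℕ → ℕ} {N : ℕ} (h0 : s N < s 0)
    (h : ∀ i j, i < j → s (i + 1) < s i → s (j + 1) ≤ s j) : Unimodal s := by
  have hex : ∃ i, s (i + 1) < s i := by
    by_contra! hc
    exact absurd (monotone_nat_of_le_succ hc (Nat.zero_le N)) (by omega)
  classical
  refine ⟨Nat.find hex, ?_, ?_⟩
  · intro a _ b hb hab
    induction b, hab using Nat.le_induction with
    | base => exact le_rfl
    | succ b hab ih =>
      have hb' : b < Nat.find hex := hb
      exact (ih hb'.le).trans (not_lt.1 (Nat.find_min hex hb'))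
  · intro a ha b _ hab
    induction b, hab using Nat.le_induction with
    | base => exact le_rfl
    | succ b hab ih =>
      refine le_trans ?_ (ih (le_trans ha hab))
      rcases (le_trans ha hab : Nat.find hex ≤ b).eq_or_lt with h1 | h1
      · rw [← h1]; exact (Nat.find_spec hex).le
      · exact h _ _ h1 (Nat.find_spec hex)

theorem Unimodal.succ_le {s : ℕ → ℕ} (hs : Unimodal s) {i j : ℕ} (hij : i < j)
    (h : s (i + 1) < s i) : s (j + 1) ≤ s j := by
  obtain ⟨k, hk, hk'⟩ := hs
  have : k ≤ i := by
    by_contra! hc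
    have : s i ≤ s (i + 1) := hk (Set.mem_Iic.2 hc.le) (Set.mem_Iic.2 hc) (Nat.le_add_right i 1)
    omega
  exact hk' (Set.mem_Ici.2 (by omega)) (Set.mem_Ici.2 (by omega)) (Nat.le_add_right j 1)

/-- The condition under which `B_{m,p} · B_{n,q}` is not rank unimodal. -/
def BadBrooms (m p n q : ℕ) : Prop := 2 ≤ m ∧ 2 ≤ n ∧ 5 ≤ m + n ∧ n ≤ p ∧ m ≤ q

theorem BadBrooms.symm {m p n q : ℕ} (h : BadBrooms m p n q) : BadBrooms n q m p := by
  unfold BadBrooms at *; omega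

theorem not_unimodal_of_badBrooms {m p n q : ℕ} {s : ℕ → ℕ}
    (hs : ∀ i, (s i : ℤ) = (broomPoly m p * broomPoly n q).coeff i) (h : BadBrooms m p n q) :
    ¬ Unimodal s := by
  intro hu
  obtain ⟨hm, hn, hmn, hp, hq⟩ := h
  -- The first degree beyond both `p + m` and `q + n`; it is at most `p + q + 1` because `m ≤ q` and
  -- `n ≤ p`, so the drop precedes the rise at `p + q + 2`.
  have h1 := coeff_diff_eq_neg_one (m := m) (n := n) (p := p) (q := q)
    (i := max (p + m) (q + n) + 1) (by omega) (by omega)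
    (by omega) (by omega)
  have h2 := coeff_diff_add m n p q 2
  have h3 := tailDiff_two_pos (p := p) (q := q) hm hn hmn
  rw [coeff_one_sub_X_mul, ← hs, ← hs] at h1
  rw [show p + q + 2 = p + q + 1 + 1 by ring, coeff_one_sub_X_mul, ← hs, ← hs] at h2
  have := hu.succ_le (i := max (p + m) (q + n)) (j := p + q + 1) (by omega) (by omega)
  omega

theorem unimodal_of_forall_coeff {m p n q : ℕ} {s : ℕ → ℕ}
    (hs : ∀ i, (s i : ℤ) = (broomPoly m p * broomPoly n q).coeff i)
    (h : ∀ i j, i < j → ((1 - X) * (broomPoly m p * broomPoly n q)).coeff i < 0 →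
      ((1 - X) * (broomPoly m p * broomPoly n q)).coeff j ≤ 0) : Unimodal s := by
  have hs0 : s 0 ≠ 0 := by
    have := hs 0
    rw [mul_coeff_zero, coeff_zero_broomPoly, coeff_zero_broomPoly] at this
    omega
  apply unimodal_of_forall (N := (broomPoly m p * broomPoly n q).natDegree + 1)
  · have := hs ((broomPoly m p * broomPoly n q).natDegree + 1)
    rw [coeff_eq_zero_of_natDegree_lt (Nat.lt_succ_self _)] at this
    omega
  · intro i j hij h1
    have := h (i + 1) (j + 1) (by omega)
      (by rw [coeff_one_sub_X_mul, ← hs, ← hs]; omega)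
    rw [coeff_one_sub_X_mul, ← hs, ← hs] at this
    omega

theorem unimodal_of_lt {m p n q : ℕ} {s : ℕ → ℕ}
    (hs : ∀ i, (s i : ℤ) = (broomPoly m p * broomPoly n q).coeff i) (hm : 0 < m) (hn : 0 < n)
    (h : q < m) : Unimodal s := by
  refine unimodal_of_forall_coeff hs fun i j hij hi => ?_
  rcases Nat.lt_or_ge i (p + q) with hlt | hge
  · exact absurd (coeff_diff_nonneg hlt (by omega)) (not_le.2 hi)
  · obtain ⟨i, rfl⟩ := Nat.exists_eq_add_of_le hge
    obtain ⟨j, rfl⟩ := Nat.exists_eq_add_of_le (hge.trans hij.le)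
    rw [coeff_diff_add] at hi ⊢
    exact tailDiff_nonpos_of_neg hm hn h (by omega) hi

theorem unimodal_of_tailDiff_nonpos {m p n q : ℕ} {s : ℕ → ℕ}
    (hs : ∀ i, (s i : ℤ) = (broomPoly m p * broomPoly n q).coeff i) (hp : n ≤ p) (hq : m ≤ q)
    (h : ∀ j, tailDiff m n p q (j + 1) ≤ 0) : Unimodal s := by
  refine unimodal_of_forall_coeff hs fun i j hij hi => ?_
  have hb (hlt : i < p + q) : p + m < i ∧ q + n < i := by
    by_contra hc
    exact absurd (coeff_diff_nonneg hlt (by omega)) (not_le.2 hi)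
  rcases Nat.lt_or_ge j (p + q) with hlt | hge
  · have := hb (hij.trans hlt)
    rw [coeff_diff_eq_neg_one (by omega) (by omega) (by omega) (by omega)]
    omega
  · obtain ⟨j, rfl⟩ := Nat.exists_eq_add_of_le hge
    rw [coeff_diff_add]
    rcases j with _ | j
    · have := hb hij
      exact tailDiff_zero_nonpos hp (by omega)
    · exact h j

theorem unimodal_iff {m p n q : ℕ} {s : ℕ → ℕ}
    (hs : ∀ i, (s i : ℤ) = (broomPoly m p * broomPoly n q).coeff i) (hm : 0 < m) (hn : 0 < n) :
    Unimodal s ↔ ¬ BadBrooms m p n q := by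
  refine ⟨fun hu h => not_unimodal_of_badBrooms hs h hu, fun h => ?_⟩
  have hs' : ∀ i, (s i : ℤ) = (broomPoly n q * broomPoly m p).coeff i := by
    simpa only [mul_comm] using hs
  rcases Nat.lt_or_ge q m with hq | hq
  · exact unimodal_of_lt hs hm hn hq
  rcases Nat.lt_or_ge p n with hp | hp
  · exact unimodal_of_lt hs' hn hm hp
  rcases Nat.eq_or_lt_of_le hm with rfl | hm
  · exact unimodal_of_tailDiff_nonpos hs hp hq fun j => tailDiff_one_nonpos hp hq
  rcases Nat.eq_or_lt_of_le hn with rfl | hn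
  · exact unimodal_of_tailDiff_nonpos hs' hq hp fun j => tailDiff_one_nonpos hq hp
  obtain ⟨rfl, rfl⟩ : m = 2 ∧ n = 2 := by unfold BadBrooms at h; omega
  exact unimodal_of_tailDiff_nonpos hs hp hq fun j => tailDiff_two_two_nonpos hp hq

/-! ### Rooted trees through parent maps; rank equals size -/

namespace RootedGraph

/-- A presentation of a rooted tree by its parent map and its depth function. -/
structure Rooting (T : RootedGraph) where
  /-- The parent of a vertex; the root is its own parent. -/
  parent : T.V → T.V
  /-- The distance from the root. -/
  depth : T.V → ℕ
  parent_root : parent T.root = T.root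
  depth_root : depth T.root = 0
  depth_parent : ∀ v, v ≠ T.root → depth (parent v) + 1 = depth v
  adj_iff : ∀ a b, T.graph.Adj a b ↔ (a ≠ T.root ∧ b = parent a) ∨ (b ≠ T.root ∧ a = parent b)

namespace Rooting

variable {T : RootedGraph} (R : Rooting T)

/-- The sets of vertices that contain the root and are closed under taking parents. -/
abbrev ClosedSets : Type := {S : Set T.V // T.root ∈ S ∧ ∀ v ∈ S, R.parent v ∈ S}

theorem adj_parent {v : T.V} (h : v ≠ T.root) : T.graph.Adj v (R.parent v) :=
  (R.adj_iff _ _).2 (.inl ⟨h, rfl⟩)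

theorem depth_pos {v : T.V} (h : v ≠ T.root) : 0 < R.depth v := by
  have := R.depth_parent v h
  omega

theorem connected_induce {S : Set T.V} (hr : T.root ∈ S) (hS : ∀ v ∈ S, R.parent v ∈ S) :
    (T.graph.induce S).Connected := by
  rw [SimpleGraph.connected_iff_exists_forall_reachable]
  refine ⟨⟨T.root, hr⟩, ?_⟩
  rintro ⟨v, hv⟩
  induction hd : R.depth v generalizing v with
  | zero =>
    have : v = T.root := by
      by_contra hne
      have := R.depth_pos hne
      omega
    subst this
    rfl
  | succ d ih =>
    have hne : v ≠ T.root := by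
      rintro rfl
      rw [R.depth_root] at hd
      omega
    have := R.depth_parent v hne
    refine (ih (R.parent v) (hS v hv) (by omega)).trans (SimpleGraph.Adj.reachable ?_)
    exact (R.adj_parent hne).symm

/-- A walk inside `S` from `v` to the root must leave the set of descendants of `v`. The only edge
that leaves it joins `v` to its parent, so the parent lies in `S`. -/
theorem parent_mem {S : Set T.V} (hr : T.root ∈ S) (hS : (T.graph.induce S).Connected)
    {v : T.V} (hv : v ∈ S) : R.parent v ∈ S := by
  by_cases hne : v = T.root
  · rw [hne, R.parent_root]; exact hr
  obtain ⟨w⟩ := hS.preconnected ⟨v, hv⟩ ⟨T.root, hr⟩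
  obtain ⟨d, -, ⟨k, hk⟩, hd2⟩ := w.exists_boundary_dart {u | ∃ k, R.parent^[k] u.1 = v} ⟨0, rfl⟩ (by
    rintro ⟨k, hk⟩
    rw [Function.iterate_fixed R.parent_root] at hk
    exact hne hk.symm)
  rcases (R.adj_iff _ _).1 d.adj with ⟨-, h⟩ | ⟨-, h⟩
  · cases k with
    | zero =>
      have hk : d.fst.1 = v := hk
      rw [← hk]
      exact (show d.snd.1 = R.parent d.fst.1 from h) ▸ d.snd.2
    | succ k => exact absurd ⟨k, by rw [← hk, Function.iterate_succ_apply]; exact congrArg _ h⟩ hd2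
  · exact absurd ⟨k + 1, by rw [← hk, Function.iterate_succ_apply]; exact congrArg _ h.symm⟩ hd2

theorem connected_induce_iff {S : Set T.V} (hr : T.root ∈ S) :
    (T.graph.induce S).Connected ↔ ∀ v ∈ S, R.parent v ∈ S :=
  ⟨fun h _ hv => R.parent_mem hr h hv, R.connected_induce hr⟩

theorem connected (R : Rooting T) : T.graph.Connected := by
  have h := R.connected_induce (S := Set.univ) (Set.mem_univ _) fun _ _ => Set.mem_univ _
  exact (SimpleGraph.induceUnivIso T.graph).connected_iff.1 h

/-- Following parents gives a walk of length `depth`; no walk is shorter, since depth changes by one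
along each edge. This makes depth invariant under isomorphism. -/
theorem dist_root (v : T.V) : T.graph.dist T.root v = R.depth v := by
  apply le_antisymm
  · induction hd : R.depth v generalizing v with
    | zero =>
      have : v = T.root := by
        by_contra hne
        have := R.depth_pos hne
        omega
      simp [this]
    | succ d ih =>
      have hne : v ≠ T.root := by
        rintro rfl
        rw [R.depth_root] at hd
        omega
      have := R.depth_parent v hne
      refine (R.connected.dist_triangle (v := R.parent v)).trans ?_
      have h1 := ih (R.parent v) (by omega)
      have h2 : T.graph.dist (R.parent v) v = 1 :=
        SimpleGraph.dist_eq_one_iff_adj.2 (R.adj_parent hne).symm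
      omega
  · obtain ⟨w, hw⟩ := R.connected.exists_walk_length_eq_dist v T.root
    rw [SimpleGraph.dist_comm, ← hw]
    clear hw
    suffices ∀ {a b : T.V} (w : T.graph.Walk a b), R.depth a ≤ w.length + R.depth b by
      simpa [R.depth_root] using this w
    intro a b w
    induction w with
    | nil => simp
    | @cons a b c h w ih =>
      rw [SimpleGraph.Walk.length_cons]
      rcases (R.adj_iff _ _).1 h with ⟨h1, rfl⟩ | ⟨h1, rfl⟩
      · have := R.depth_parent a h1
        omega
      · have := R.depth_parent b h1
        omega

/-- Removing a deepest non-root vertex leaves a closed set, since that vertex is the parent of no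
other member. So every chain can be refined to steps of size one. -/
theorem exists_lt_ncard [Finite T.V] (R : Rooting T) {x : T.C} (hx : 1 < x.1.ncard) :
    ∃ y < x, y.1.ncard + 1 = x.1.ncard := by
  obtain ⟨w, hw, hwr⟩ := Set.exists_ne_of_one_lt_ncard hx T.root
  obtain ⟨v, ⟨hv, hvr⟩, hmax⟩ := (x.1 \ {T.root}).exists_max_image R.depth (Set.toFinite _)
    ⟨w, hw, hwr⟩
  have hvr : v ≠ T.root := hvr
  have hcl : ∀ u ∈ x.1 \ {v}, R.parent u ∈ x.1 \ {v} := by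
    rintro u ⟨hu, -⟩
    refine ⟨R.parent_mem x.2.1 x.2.2 hu, fun h => ?_⟩
    have h : R.parent u = v := h
    by_cases hur : u = T.root
    · rw [hur, R.parent_root] at h
      exact hvr h.symm
    · have h1 := hmax u ⟨hu, hur⟩
      have h2 := R.depth_parent u hur
      rw [h] at h2
      omega
  have hr : T.root ∈ x.1 \ {v} := ⟨x.2.1, hvr.symm⟩
  refine ⟨⟨x.1 \ {v}, hr, R.connected_induce hr hcl⟩, ?_, Set.ncard_sdiff_singleton_add_one hv⟩
  exact Set.sdiff_singleton_ssubset.2 hv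

theorem height_eq [Finite T.V] (R : Rooting T) {n : ℕ} {x : T.C} (hx : x.1.ncard = n + 1) :
    Order.height x = n := by
  induction n using Nat.strong_induction_on generalizing x with
  | _ n ih =>
    apply le_antisymm
    · rw [Order.height_le_coe_iff]
      intro y hy
      have h1 : y.1.ncard < x.1.ncard := Set.ncard_lt_ncard hy
      have h2 : 0 < y.1.ncard := (Set.ncard_pos).2 ⟨_, y.2.1⟩
      rw [ih (y.1.ncard - 1) (by omega) (x := y) (by omega)]
      exact_mod_cast (by omega)
    · rcases n with _ | n
      · simp
      · obtain ⟨y, hy, hy'⟩ := R.exists_lt_ncard (x := x) (by omega)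
        have := Order.height_add_one_le hy
        rw [ih n (by omega) (x := y) (by omega)] at this
        exact_mod_cast this

theorem rankSequence_eq [Finite T.V] (i : ℕ) :
    rankSequence T.C i = Nat.card {S : R.ClosedSets // S.1.ncard - 1 = i} := by
  have key (x : T.C) : Order.height x = i ↔ x.1.ncard - 1 = i := by
    have h : 0 < x.1.ncard := (Set.ncard_pos).2 ⟨_, x.2.1⟩
    rw [R.height_eq (n := x.1.ncard - 1) (by omega)]
    exact_mod_cast Iff.rfl
  rw [rankSequence, ← Nat.card_coe_set_eq]
  refine Nat.card_congr (Equiv.subtypeEquiv (Equiv.subtypeEquivRight fun S => ?_) key)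
  exact and_congr_right fun hr => R.connected_induce_iff hr

noncomputable instance [Finite T.V] : Fintype R.ClosedSets := Fintype.ofFinite _

/-- The generating polynomial of the number of closed sets by the number of non-root elements. -/
noncomputable def poly [Finite T.V] : ℤ[X] := ∑ S : R.ClosedSets, X ^ (S.1.ncard - 1)

theorem rankSequence_eq_coeff [Finite T.V] (i : ℕ) :
    (rankSequence T.C i : ℤ) = R.poly.coeff i := by
  classical
  rw [R.rankSequence_eq, poly, finsetSum_coeff, Nat.card_eq_fintype_card, Fintype.card_subtype]
  simp only [coeff_X_pow, Finset.sum_boole, eq_comm]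

end Rooting

/-! ### Merges: the two inclusions, commutativity, multiplicativity of the polynomial -/

section Merge

variable (S T : RootedGraph)

/-- The inclusion of the left factor into a merge. -/
def mergeInl (a : S.V) : (S.merge T).V := Sum.inl a

open Classical in
/-- The inclusion of the right factor into a merge. -/
noncomputable def mergeInr (b : T.V) : (S.merge T).V :=
  if h : b = T.root then Sum.inl S.root else Sum.inr ⟨b, h⟩

theorem mergeInl_root : mergeInl S T S.root = (S.merge T).root := rfl

theorem mergeInr_root : mergeInr S T T.root = (S.merge T).root := dif_pos rfl

variable {S T}

theorem mergeInr_of_ne {b : T.V} (h : b ≠ T.root) : mergeInr S T b = Sum.inr ⟨b, h⟩ := dif_neg h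

theorem mergeInl_injective : Function.Injective (mergeInl S T) := Sum.inl_injective

theorem mergeInl_eq_mergeInr {a : S.V} {b : T.V} :
    mergeInl S T a = mergeInr S T b ↔ a = S.root ∧ b = T.root := by
  by_cases h : b = T.root
  · subst h
    rw [mergeInr_root, ← mergeInl_root, mergeInl_injective.eq_iff]
    simp
  · rw [mergeInr_of_ne h]
    exact iff_of_false Sum.inl_ne_inr fun h' => h h'.2

theorem mergeInr_injective : Function.Injective (mergeInr S T) := by
  intro a b h
  by_cases hb : b = T.root
  · subst hb
    rw [mergeInr_root, ← mergeInl_root, eq_comm, mergeInl_eq_mergeInr] at h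
    exact h.2
  · by_cases ha : a = T.root
    · subst ha
      rw [mergeInr_root, ← mergeInl_root, mergeInl_eq_mergeInr] at h
      exact h.2.symm
    · rw [mergeInr_of_ne ha, mergeInr_of_ne hb] at h
      exact congrArg Subtype.val (Sum.inr_injective h)

theorem merge_cases (v : (S.merge T).V) :
    (∃ a, v = mergeInl S T a) ∨ ∃ b, b ≠ T.root ∧ v = mergeInr S T b := by
  rcases v with a | b
  · exact .inl ⟨a, rfl⟩
  · exact .inr ⟨b.1, b.2, (mergeInr_of_ne b.2).symm⟩

theorem mergeInl_eq_root {a : S.V} : mergeInl S T a = (S.merge T).root ↔ a = S.root := by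
  rw [← mergeInl_root, mergeInl_injective.eq_iff]

theorem mergeInr_eq_root {b : T.V} : mergeInr S T b = (S.merge T).root ↔ b = T.root := by
  rw [← mergeInr_root, mergeInr_injective.eq_iff]

theorem adj_mergeInl_mergeInr {a : S.V} {b : T.V} (hb : b ≠ T.root) :
    (S.merge T).graph.Adj (mergeInl S T a) (mergeInr S T b) ↔
      a = S.root ∧ T.graph.Adj T.root b := by
  rw [mergeInr_of_ne hb]; exact Iff.rfl

theorem adj_mergeInr {a b : T.V} :
    (S.merge T).graph.Adj (mergeInr S T a) (mergeInr S T b) ↔ T.graph.Adj a b := by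
  by_cases ha : a = T.root <;> by_cases hb : b = T.root
  · subst ha; rw [hb]; simp
  · subst ha
    rw [mergeInr_root, ← mergeInl_root, adj_mergeInl_mergeInr hb]
    simp
  · subst hb
    rw [mergeInr_root, ← mergeInl_root, SimpleGraph.adj_comm, adj_mergeInl_mergeInr ha,
      SimpleGraph.adj_comm]
    simp
  · rw [mergeInr_of_ne ha, mergeInr_of_ne hb]; exact Iff.rfl

/-- The merge stores the common root in the left factor only; this description treats both factors
alike. -/
theorem merge_adj_iff {v w : (S.merge T).V} : (S.merge T).graph.Adj v w ↔
    (∃ a b, v = mergeInl S T a ∧ w = mergeInl S T b ∧ S.graph.Adj a b) ∨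
      ∃ a b, v = mergeInr S T a ∧ w = mergeInr S T b ∧ T.graph.Adj a b := by
  constructor
  · intro h
    rcases merge_cases v with ⟨a, rfl⟩ | ⟨a, ha, rfl⟩ <;>
      rcases merge_cases w with ⟨b, rfl⟩ | ⟨b, hb, rfl⟩
    · exact .inl ⟨a, b, rfl, rfl, h⟩
    · rw [adj_mergeInl_mergeInr hb] at h
      obtain ⟨rfl, h⟩ := h
      exact .inr ⟨T.root, b, by rw [mergeInr_root, mergeInl_root], rfl, h⟩
    · rw [SimpleGraph.adj_comm, adj_mergeInl_mergeInr ha] at h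
      obtain ⟨rfl, h⟩ := h
      exact .inr ⟨a, T.root, rfl, by rw [mergeInr_root, mergeInl_root], h.symm⟩
    · exact .inr ⟨a, b, rfl, rfl, adj_mergeInr.1 h⟩
  · rintro (⟨a, b, rfl, rfl, h⟩ | ⟨a, b, rfl, rfl, h⟩)
    · exact h
    · exact adj_mergeInr.2 h

/-- The map that exchanges the two factors of a merge. -/
noncomputable def mergeSwap (S T : RootedGraph) : (S.merge T).V → (T.merge S).V :=
  Sum.elim (mergeInr T S) fun b => mergeInl T S b.1

theorem mergeSwap_mergeInl (a : S.V) : mergeSwap S T (mergeInl S T a) = mergeInr T S a := rfl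

theorem mergeSwap_mergeInr (b : T.V) : mergeSwap S T (mergeInr S T b) = mergeInl T S b := by
  by_cases hb : b = T.root
  · subst hb
    rw [mergeInr_root, ← mergeInl_root, mergeSwap_mergeInl, mergeInr_root, mergeInl_root]
  · rw [mergeInr_of_ne hb]; rfl

theorem mergeSwap_mergeSwap (v : (S.merge T).V) : mergeSwap T S (mergeSwap S T v) = v := by
  rcases merge_cases v with ⟨a, rfl⟩ | ⟨b, -, rfl⟩
  · rw [mergeSwap_mergeInl, mergeSwap_mergeInr]
  · rw [mergeSwap_mergeInr, mergeSwap_mergeInl]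

theorem adj_mergeSwap {v w : (S.merge T).V} (h : (S.merge T).graph.Adj v w) :
    (T.merge S).graph.Adj (mergeSwap S T v) (mergeSwap S T w) := by
  rcases merge_adj_iff.1 h with ⟨a, b, rfl, rfl, hab⟩ | ⟨a, b, rfl, rfl, hab⟩
  · exact adj_mergeInr.2 hab
  · rw [mergeSwap_mergeInr, mergeSwap_mergeInr]; exact hab

theorem merge_comm (S T : RootedGraph) : Isomorphic (S.merge T) (T.merge S) :=
  ⟨{ toFun := mergeSwap S T
     invFun := mergeSwap T S
     left_inv := mergeSwap_mergeSwap
     right_inv := mergeSwap_mergeSwap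
     map_rel_iff' := by
       intro v w
       refine ⟨fun h => ?_, adj_mergeSwap⟩
       have := adj_mergeSwap h
       simp only [Equiv.coe_fn_mk, mergeSwap_mergeSwap] at this
       exact this }, mergeInr_root T S⟩

end Merge

namespace Rooting

variable {S T : RootedGraph} (R : Rooting S) (Q : Rooting T)

/-- The parent map of a merge. -/
noncomputable def mergeParent : (S.merge T).V → (S.merge T).V :=
  Sum.elim (fun a => mergeInl S T (R.parent a)) fun b => mergeInr S T (Q.parent b.1)

/-- The depth function of a merge. -/
def mergeDepth : (S.merge T).V → ℕ := Sum.elim R.depth fun b => Q.depth b.1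

theorem mergeParent_mergeInl (a : S.V) :
    mergeParent R Q (mergeInl S T a) = mergeInl S T (R.parent a) := rfl

theorem mergeParent_mergeInr (b : T.V) :
    mergeParent R Q (mergeInr S T b) = mergeInr S T (Q.parent b) := by
  by_cases hb : b = T.root
  · subst hb
    rw [Q.parent_root, mergeInr_root, ← mergeInl_root, mergeParent_mergeInl, R.parent_root]
  · rw [mergeInr_of_ne hb]; rfl

theorem mergeDepth_mergeInl (a : S.V) : mergeDepth R Q (mergeInl S T a) = R.depth a := rfl

theorem mergeDepth_mergeInr (b : T.V) : mergeDepth R Q (mergeInr S T b) = Q.depth b := by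
  by_cases hb : b = T.root
  · subst hb
    rw [Q.depth_root, mergeInr_root, ← mergeInl_root, mergeDepth_mergeInl, R.depth_root]
  · rw [mergeInr_of_ne hb]; rfl

/-- The rooting of a merge. -/
noncomputable def merge : Rooting (S.merge T) where
  parent := mergeParent R Q
  depth := mergeDepth R Q
  parent_root := congrArg (mergeInl S T) R.parent_root
  depth_root := R.depth_root
  depth_parent v h := by
    rcases merge_cases v with ⟨a, rfl⟩ | ⟨b, -, rfl⟩
    · rw [mergeParent_mergeInl, mergeDepth_mergeInl, mergeDepth_mergeInl]
      exact R.depth_parent a (mt mergeInl_eq_root.2 h)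
    · rw [mergeParent_mergeInr, mergeDepth_mergeInr, mergeDepth_mergeInr]
      exact Q.depth_parent b (mt mergeInr_eq_root.2 h)
  adj_iff v w := by
    have main (v w) (hv : v ≠ (S.merge T).root) (hw : w = mergeParent R Q v) :
        (S.merge T).graph.Adj v w := by
      subst hw
      rcases merge_cases v with ⟨a, rfl⟩ | ⟨b, -, rfl⟩
      · rw [mergeParent_mergeInl]
        exact R.adj_parent (mt mergeInl_eq_root.2 hv)
      · rw [mergeParent_mergeInr, adj_mergeInr]
        exact Q.adj_parent (mt mergeInr_eq_root.2 hv)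
    constructor
    · intro h
      rcases merge_adj_iff.1 h with ⟨a, b, rfl, rfl, hab⟩ | ⟨a, b, rfl, rfl, hab⟩
      · simp only [ne_eq, mergeInl_eq_root, mergeParent_mergeInl, mergeInl_injective.eq_iff]
        exact (R.adj_iff a b).1 hab
      · simp only [ne_eq, mergeInr_eq_root, mergeParent_mergeInr, mergeInr_injective.eq_iff]
        exact (Q.adj_iff a b).1 hab
    · rintro (⟨hv, hw⟩ | ⟨hv, hw⟩)
      · exact main v w hv hw
      · exact (main w v hv hw).symm

theorem merge_parent_mergeInl (a : S.V) :
    (R.merge Q).parent (mergeInl S T a) = mergeInl S T (R.parent a) := rfl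

theorem merge_parent_mergeInr (b : T.V) :
    (R.merge Q).parent (mergeInr S T b) = mergeInr S T (Q.parent b) := mergeParent_mergeInr R Q b

/-- A closed set of a merge is a pair of closed sets. -/
noncomputable def closedSetsMergeEquiv :
    R.ClosedSets × Q.ClosedSets ≃ (R.merge Q).ClosedSets where
  toFun AB := ⟨mergeInl S T '' AB.1.1 ∪ mergeInr S T '' AB.2.1,
    .inl ⟨S.root, AB.1.2.1, rfl⟩, by
      rintro _ (⟨a, ha, rfl⟩ | ⟨b, hb, rfl⟩)
      · exact .inl ⟨_, AB.1.2.2 a ha, rfl⟩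
      · exact .inr ⟨_, AB.2.2.2 b hb, (merge_parent_mergeInr R Q b).symm⟩⟩
  invFun C := (⟨mergeInl S T ⁻¹' C.1, C.2.1, fun a ha => C.2.2 _ ha⟩,
    ⟨mergeInr S T ⁻¹' C.1, by rw [Set.mem_preimage, mergeInr_root]; exact C.2.1, fun b hb => by
      rw [Set.mem_preimage, ← merge_parent_mergeInr R Q]; exact C.2.2 _ hb⟩)
  left_inv := by
    rintro ⟨⟨A, hA, -⟩, ⟨B, hB, -⟩⟩
    refine Prod.ext (Subtype.ext ?_) (Subtype.ext ?_) <;> ext v <;>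
      simp only [Set.mem_preimage, Set.mem_union, Set.mem_image, mergeInl_injective.eq_iff,
        mergeInr_injective.eq_iff, exists_eq_right, eq_comm (b := mergeInl S T _),
        mergeInl_eq_mergeInr]
    · refine ⟨?_, .inl⟩
      rintro (h | ⟨b, -, rfl, -⟩)
      exacts [h, hA]
    · refine ⟨?_, .inr⟩
      rintro (⟨b, -, -, rfl⟩ | h)
      exacts [hB, h]
  right_inv := by
    rintro ⟨C, hC⟩
    refine Subtype.ext (Set.ext fun v => ⟨?_, fun hv => ?_⟩)
    · rintro (⟨a, ha, rfl⟩ | ⟨a, ha, rfl⟩) <;> exact ha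
    · rcases merge_cases v with ⟨a, rfl⟩ | ⟨b, -, rfl⟩
      · exact .inl ⟨a, hv, rfl⟩
      · exact .inr ⟨b, hv, rfl⟩

/-- The two images meet in the root alone, so the number of non-root elements is additive. -/
theorem ncard_closedSetsMergeEquiv [Finite S.V] [Finite T.V] (A : R.ClosedSets)
    (B : Q.ClosedSets) :
    (closedSetsMergeEquiv R Q (A, B)).1.ncard - 1 = (A.1.ncard - 1) + (B.1.ncard - 1) := by
  have h1 := Set.ncard_union_add_ncard_inter (mergeInl S T '' A.1) (mergeInr S T '' B.1)
    (Set.toFinite _) (Set.toFinite _)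
  have h2 : mergeInl S T '' A.1 ∩ mergeInr S T '' B.1 = {(S.merge T).root} := by
    ext v
    simp only [Set.mem_inter_iff, Set.mem_image, Set.mem_singleton_iff]
    constructor
    · rintro ⟨⟨a, -, rfl⟩, ⟨b, -, h⟩⟩
      rw [mergeInl_eq_root]
      exact (mergeInl_eq_mergeInr.1 h.symm).1
    · rintro rfl
      exact ⟨⟨_, A.2.1, rfl⟩, ⟨_, B.2.1, mergeInr_root S T⟩⟩
  rw [h2, Set.ncard_singleton, Set.ncard_image_of_injective _ mergeInl_injective,
    Set.ncard_image_of_injective _ mergeInr_injective] at h1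
  have hA : 0 < A.1.ncard := (Set.ncard_pos).2 ⟨_, A.2.1⟩
  have hB : 0 < B.1.ncard := (Set.ncard_pos).2 ⟨_, B.2.1⟩
  change (mergeInl S T '' A.1 ∪ mergeInr S T '' B.1).ncard - 1 = _
  omega

instance [Finite S.V] [Finite T.V] : Finite (S.merge T).V :=
  inferInstanceAs (Finite (S.V ⊕ {w : T.V // w ≠ T.root}))

theorem poly_merge [Finite S.V] [Finite T.V] : (R.merge Q).poly = R.poly * Q.poly := by
  rw [poly, poly, poly, Finset.sum_mul_sum, ← Finset.sum_product', Finset.univ_product_univ,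
    ← (closedSetsMergeEquiv R Q).sum_comp]
  refine Finset.sum_congr rfl fun AB _ => ?_
  rw [ncard_closedSetsMergeEquiv R Q AB.1 AB.2, pow_add]

end Rooting

theorem card_merge (S T : RootedGraph) [Finite S.V] [Finite T.V] :
    Nat.card (S.merge T).V + 1 = Nat.card S.V + Nat.card T.V := by
  classical
  have := Fintype.ofFinite T.V
  have h : Nat.card (S.merge T).V = Nat.card (S.V ⊕ {w : T.V // w ≠ T.root}) := rfl
  rw [h, Nat.card_sum, Nat.card_eq_fintype_card (α := {w : T.V // w ≠ T.root}),
    Nat.card_eq_fintype_card (α := T.V), Fintype.card_subtype_compl, Fintype.card_subtype_eq]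
  have : 0 < Fintype.card T.V := Fintype.card_pos_iff.2 ⟨T.root⟩
  omega

end RootedGraph

/-! ### Closed sets and the polynomial of a broom -/

namespace RootedGraph

instance (m k : ℕ) : Finite (broom m k).V := inferInstanceAs (Finite (Fin (m + k + 1)))

theorem card_broom (m k : ℕ) : Nat.card (broom m k).V = m + k + 1 := Nat.card_fin _

theorem broom_adj {m k : ℕ} {a b : Fin (m + k + 1)} : (broom m k).graph.Adj a b ↔
    (a ≠ 0 ∧ b.val = if a.val ≤ k then a.val - 1 else k) ∨
      (b ≠ 0 ∧ a.val = if b.val ≤ k then b.val - 1 else k) := by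
  change (SimpleGraph.fromRel fun a b : Fin (m + k + 1) =>
    (b.val ≤ k ∧ b.val = a.val + 1) ∨ (k < b.val ∧ a.val = k)).Adj a b ↔ _
  rw [SimpleGraph.fromRel_adj]
  simp only [ne_eq, Fin.ext_iff, Fin.val_zero]
  split_ifs <;> omega

/-- The rooting of a broom. -/
def broomRooting (m k : ℕ) : Rooting (broom m k) where
  parent (a : Fin (m + k + 1)) := ⟨if a.val ≤ k then a.val - 1 else k, by split_ifs <;> omega⟩
  depth (a : Fin (m + k + 1)) := min a.val (k + 1)
  parent_root := rfl
  depth_root := Nat.zero_min _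
  depth_parent (a : Fin (m + k + 1)) (h : a ≠ 0) := by
    have : a.val ≠ 0 := fun h' => h (Fin.ext h')
    dsimp only
    split_ifs <;> omega
  adj_iff _ _ := broom_adj.trans (or_congr
    (and_congr_right fun _ => ⟨fun h => Fin.ext h, fun h => congrArg Fin.val h⟩)
    (and_congr_right fun _ => ⟨fun h => Fin.ext h, fun h => congrArg Fin.val h⟩))

theorem broomRooting_depth {m k : ℕ} (a : Fin (m + k + 1)) :
    (broomRooting m k).depth a = min a.val (k + 1) := rfl

/-- The set of vertices of a broom that consists of the first part of the handle, or of the handle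
and of some of the pendant vertices. -/
def broomSet (m k : ℕ) : Fin k ⊕ Finset (Fin m) → Set (Fin (m + k + 1))
  | .inl i => {a | a.val ≤ i.val}
  | .inr s => {a | a.val ≤ k ∨ ∃ j ∈ s, a.val = k + 1 + j.val}

theorem broomSet_injective (m k : ℕ) : Function.Injective (broomSet m k) := by
  rintro (i | s) (j | t) h <;> simp only [broomSet, Set.ext_iff, Set.mem_ofPred_eq] at h
  · congr 1
    have h1 := h ⟨i, by omega⟩
    have h2 := h ⟨j, by omega⟩
    simp only [le_refl, true_iff, iff_true] at h1 h2
    exact Fin.ext (le_antisymm h1 h2)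
  · have := h ⟨k, by omega⟩
    simp only [le_refl, true_or, iff_true] at this
    omega
  · have := h ⟨k, by omega⟩
    simp only [le_refl, true_or, true_iff] at this
    omega
  · congr 1
    ext j
    have := h ⟨k + 1 + j, by omega⟩
    have hk : ¬ k + 1 + j.val ≤ k := by omega
    simpa [hk, ← Fin.ext_iff] using this

theorem broomSet_closed (m k : ℕ) (x : Fin k ⊕ Finset (Fin m)) :
    (broom m k).root ∈ broomSet m k x ∧
      ∀ v ∈ broomSet m k x, (broomRooting m k).parent v ∈ broomSet m k x := by
  rcases x with i | s
  · refine ⟨Nat.zero_le _, fun v (hv : v.val ≤ i) => ?_⟩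
    change (if v.val ≤ k then v.val - 1 else k) ≤ i.val
    split_ifs <;> omega
  · refine ⟨.inl (Nat.zero_le _), fun v _ => .inl ?_⟩
    change (if v.val ≤ k then v.val - 1 else k) ≤ k
    split_ifs <;> omega

theorem exists_broomSet_eq {m k : ℕ} (A : Set (Fin (m + k + 1))) (h0 : (0 : Fin (m + k + 1)) ∈ A)
    (hA : ∀ v ∈ A, (broomRooting m k).parent v ∈ A) : ∃ x, broomSet m k x = A := by
  classical
  have hstep (a b : Fin (m + k + 1)) (hab : b.val = if a.val ≤ k then a.val - 1 else k)
      (ha : a ∈ A) : b ∈ A := by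
    have := hA a ha
    rwa [show (broomRooting m k).parent a = b from Fin.ext hab.symm] at this
  have hdown (b : ℕ) (hb : b ≤ k) (d : ℕ) (hbd : b + d ≤ k)
      (h : (⟨b + d, by omega⟩ : Fin (m + k + 1)) ∈ A) : (⟨b, by omega⟩ : Fin (m + k + 1)) ∈ A := by
    induction d with
    | zero => exact h
    | succ d ih =>
      refine ih (by omega) (hstep _ _ ?_ h)
      simp only
      rw [if_pos (by omega)]
      omega
  by_cases hk : (⟨k, by omega⟩ : Fin (m + k + 1)) ∈ A
  · refine ⟨.inr (univ.filter fun j : Fin m => (⟨k + 1 + j, by omega⟩ : Fin (m + k + 1)) ∈ A), ?_⟩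
    ext a
    simp only [broomSet, Set.mem_ofPred_eq, Finset.mem_filter, Finset.mem_univ, true_and]
    constructor
    · rintro (h | ⟨j, hj, h⟩)
      · refine hdown a.val h (k - a.val) (by omega) ?_
        simpa only [Nat.add_sub_cancel' h] using hk
      · rwa [show a = ⟨k + 1 + j, by omega⟩ from Fin.ext h]
    · intro ha
      by_cases h : a.val ≤ k
      · exact .inl h
      · refine .inr ⟨⟨a.val - (k + 1), by omega⟩, ?_, by simp only; omega⟩
        simpa only [show k + 1 + (a.val - (k + 1)) = a.val by omega] using ha
  -- Without the end of the handle no pendant vertex can occur, so `A` is the part of the handle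
  -- before its least missing vertex, which is not the root.
  · have hex : ∃ j, ∃ h : j ≤ k, (⟨j, by omega⟩ : Fin (m + k + 1)) ∉ A := ⟨k, le_rfl, hk⟩
    obtain ⟨hj, hjA⟩ := Nat.find_spec hex
    have hpos : Nat.find hex ≠ 0 := by
      intro h
      apply hjA
      simp only [h]
      exact h0
    refine ⟨.inl ⟨Nat.find hex - 1, by omega⟩, ?_⟩
    ext a
    simp only [broomSet, Set.mem_ofPred_eq]
    constructor
    · intro ha
      by_contra hc
      exact Nat.find_min hex (m := a.val) (by omega) ⟨by omega, hc⟩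
    · intro ha
      by_contra hc
      by_cases hak : a.val ≤ k
      · refine hjA (hdown _ hj (a.val - Nat.find hex) (by omega) ?_)
        simpa only [show Nat.find hex + (a.val - Nat.find hex) = a.val by omega] using ha
      · exact hk (hstep a _ (by simp [hak]) ha)

theorem ncard_broomSet_inl {m k : ℕ} (i : Fin k) :
    (broomSet m k (.inl i)).ncard - 1 = i := by
  have : broomSet m k (.inl i) = ((Finset.Iic (⟨i, by omega⟩ : Fin (m + k + 1)) : Finset _) :
      Set (Fin (m + k + 1))) := by
    ext a
    simp [broomSet, Fin.le_def]
  rw [this, Set.ncard_coe_finset, Fin.card_Iic]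
  simp

/-- The pendant vertices of a broom. -/
def pendant (m k : ℕ) : Fin m ↪ Fin (m + k + 1) where
  toFun j := ⟨k + 1 + j, by omega⟩
  inj' i j h := Fin.ext (by simpa using congrArg Fin.val h)

theorem pendant_val {m k : ℕ} (j : Fin m) : (pendant m k j).val = k + 1 + j := rfl

theorem ncard_broomSet_inr {m k : ℕ} (s : Finset (Fin m)) :
    (broomSet m k (.inr s)).ncard - 1 = k + #s := by
  have : broomSet m k (.inr s) = ((Finset.Iic (⟨k, by omega⟩ : Fin (m + k + 1)) ∪
      s.map (pendant m k) : Finset _) : Set (Fin (m + k + 1))) := by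
    ext a
    simp [broomSet, Fin.le_def, Fin.ext_iff, eq_comm, pendant_val]
  rw [this, Set.ncard_coe_finset, Finset.card_union_of_disjoint, Fin.card_Iic, Finset.card_map]
  · change k + 1 + #s - 1 = _
    omega
  · rw [Finset.disjoint_left]
    intro a ha h
    simp only [Finset.mem_Iic, Fin.le_def, Finset.mem_map] at ha h
    obtain ⟨j, -, rfl⟩ := h
    rw [pendant_val] at ha
    omega

/-- The closed sets of a broom. -/
noncomputable def broomClosedSetsEquiv (m k : ℕ) :
    Fin k ⊕ Finset (Fin m) ≃ (broomRooting m k).ClosedSets :=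
  Equiv.ofBijective (fun x => ⟨broomSet m k x, broomSet_closed m k x⟩)
    ⟨fun x y h => broomSet_injective m k (congrArg Subtype.val h), fun ⟨A, h0, hA⟩ => by
      obtain ⟨x, hx⟩ := exists_broomSet_eq A h0 hA
      exact ⟨x, Subtype.ext hx⟩⟩

theorem poly_broomRooting (m k : ℕ) : (broomRooting m k).poly = broomPoly m k := by
  rw [Rooting.poly, ← (broomClosedSetsEquiv m k).sum_comp, Fintype.sum_sum_type, broomPoly,
    ← Fin.sum_univ_eq_sum_range]
  congr 1
  · exact Finset.sum_congr rfl fun i _ => congrArg _ (ncard_broomSet_inl i)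
  · have := Fin.sum_pow_mul_eq_add_pow (n := m) (X : ℤ[X]) 1
    rw [add_comm 1 X, ← this, Finset.mul_sum]
    refine Finset.sum_congr rfl fun s _ => ?_
    rw [one_pow, mul_one, ← pow_add]
    exact congrArg _ (ncard_broomSet_inr s)

theorem rankUnimodal_merge_broom_iff {m n : ℕ} (hm : 0 < m) (hn : 0 < n) (p q : ℕ) :
    RankUnimodal (merge (broom m p) (broom n q)).C ↔ ¬ BadBrooms m p n q := by
  refine unimodal_iff (fun i => ?_) hm hn
  rw [((broomRooting m p).merge (broomRooting n q)).rankSequence_eq_coeff, Rooting.poly_merge,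
    poly_broomRooting, poly_broomRooting]

theorem card_merge_broom (m n p q : ℕ) :
    Nat.card (merge (broom m p) (broom n q)).V = m + n + p + q + 1 := by
  have := card_merge (broom m p) (broom n q)
  rw [card_broom, card_broom] at this
  omega

/-! ### Isomorphism classes of bad merges -/

/-- The pairs of the depth and the number of children of the vertices with at least two children
other than the root. -/
def forkSet (T : RootedGraph) : Set (ℕ × ℕ) :=
  {x | 2 ≤ x.2 ∧ ∃ v, v ≠ T.root ∧ T.graph.dist T.root v = x.1 ∧
    {w | T.graph.Adj v w ∧ T.graph.dist T.root w = T.graph.dist T.root v + 1}.ncard = x.2}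

theorem dist_iso {V W : Type} {G : SimpleGraph V} {H : SimpleGraph W} (hG : G.Connected)
    (f : G ≃g H) (a b : V) : H.dist (f a) (f b) = G.dist a b := by
  have key {V W : Type} {G : SimpleGraph V} {H : SimpleGraph W} (hG : G.Connected)
      (f : G ≃g H) (a b : V) : H.dist (f a) (f b) ≤ G.dist a b := by
    obtain ⟨w, hw⟩ := hG.exists_walk_length_eq_dist a b
    rw [← hw, ← SimpleGraph.Walk.length_map f.toHom w]
    exact SimpleGraph.dist_le _
  refine le_antisymm (key hG f a b) ?_
  simpa using key (f.connected_iff.1 hG) f.symm (f a) (f b)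

theorem Isomorphic.forkSet_subset {S T : RootedGraph} (hS : S.graph.Connected)
    (h : Isomorphic S T) : forkSet S ⊆ forkSet T := by
  obtain ⟨f, hf⟩ := h
  rintro ⟨d, e⟩ ⟨he, v, hv, hd, hc⟩
  refine ⟨he, f v, fun h => hv (f.injective (h.trans hf.symm)), ?_, ?_⟩
  · rw [← hf, dist_iso hS]; exact hd
  · rw [← hc, ← Set.ncard_image_of_injective _ f.injective]
    congr 1
    ext w
    obtain ⟨w, rfl⟩ := f.surjective w
    simp only [Set.mem_ofPred_eq, ← hf, dist_iso hS, f.map_adj_iff, Set.mem_image,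
      f.injective.eq_iff, exists_eq_right]

theorem Isomorphic.forkSet_eq {S T : RootedGraph} (hS : S.graph.Connected)
    (h : Isomorphic S T) : forkSet S = forkSet T := by
  obtain ⟨f, hf⟩ := h
  refine (Isomorphic.forkSet_subset hS ⟨f, hf⟩).antisymm
    (Isomorphic.forkSet_subset (f.connected_iff.1 hS) ⟨f.symm, ?_⟩)
  rw [← hf]
  exact f.symm_apply_apply _

theorem Rooting.forkSet_eq {T : RootedGraph} (R : Rooting T) :
    forkSet T = {x | 2 ≤ x.2 ∧ ∃ v, v ≠ T.root ∧ R.depth v = x.1 ∧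
      {w | w ≠ T.root ∧ R.parent w = v}.ncard = x.2} := by
  have key (v : T.V) : {w | T.graph.Adj v w ∧ T.graph.dist T.root w = T.graph.dist T.root v + 1} =
      {w | w ≠ T.root ∧ R.parent w = v} := by
    ext w
    simp only [Set.mem_ofPred_eq, R.dist_root, R.adj_iff]
    constructor
    · rintro ⟨⟨hv, rfl⟩ | ⟨hw, rfl⟩, h⟩
      · have := R.depth_parent v hv
        omega
      · exact ⟨hw, rfl⟩
    · rintro ⟨hw, rfl⟩
      exact ⟨.inr ⟨hw, rfl⟩, (R.depth_parent w hw).symm⟩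
  simp only [forkSet, key]
  simp only [R.dist_root]

/-- Merging changes the children of the root only, and the root is excluded from `forkSet`. -/
theorem forkSet_merge {S T : RootedGraph} (R : Rooting S) (Q : Rooting T) :
    forkSet (S.merge T) = forkSet S ∪ forkSet T := by
  have hl (a : S.V) (ha : a ≠ S.root) :
      {w | w ≠ (S.merge T).root ∧ (R.merge Q).parent w = mergeInl S T a}.ncard =
        {w | w ≠ S.root ∧ R.parent w = a}.ncard := by
    rw [← Set.ncard_image_of_injective _ (mergeInl_injective (S := S) (T := T))]
    congr 1
    ext w
    rcases merge_cases w with ⟨b, rfl⟩ | ⟨b, hb, rfl⟩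
    · simp [mergeInl_eq_root, Rooting.merge_parent_mergeInl, mergeInl_injective.eq_iff]
    · simp [mergeInl_eq_mergeInr, Rooting.merge_parent_mergeInr, eq_comm (b := mergeInl S T _),
        ha, hb]
  have hr (a : T.V) (ha : a ≠ T.root) :
      {w | w ≠ (S.merge T).root ∧ (R.merge Q).parent w = mergeInr S T a}.ncard =
        {w | w ≠ T.root ∧ Q.parent w = a}.ncard := by
    rw [← Set.ncard_image_of_injective _ (mergeInr_injective (S := S) (T := T))]
    congr 1
    ext w
    by_cases hw : w = (S.merge T).root
    · subst hw
      simp [mergeInr_eq_root]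
    rcases merge_cases w with ⟨b, rfl⟩ | ⟨b, hb, rfl⟩
    · rw [mergeInl_eq_root] at hw
      simp [eq_comm (b := mergeInl S T _), mergeInl_eq_mergeInr, Rooting.merge_parent_mergeInl, ha, hw]
    · simp [mergeInr_eq_root, Rooting.merge_parent_mergeInr, mergeInr_injective.eq_iff]
  rw [(R.merge Q).forkSet_eq, R.forkSet_eq, Q.forkSet_eq]
  ext ⟨d, e⟩
  simp only [Set.mem_ofPred_eq, Set.mem_union, ← and_or_left, and_congr_right_iff]
  intro _
  constructor
  · rintro ⟨v, hv, hd, hc⟩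
    rcases merge_cases v with ⟨a, rfl⟩ | ⟨a, ha, rfl⟩
    · rw [ne_eq, mergeInl_eq_root] at hv
      rw [hl a hv] at hc
      exact .inl ⟨a, hv, hd, hc⟩
    · rw [hr a ha] at hc
      exact .inr ⟨a, ha, (Rooting.mergeDepth_mergeInr R Q a).symm.trans hd, hc⟩
  · rintro (⟨a, ha, hd, hc⟩ | ⟨a, ha, hd, hc⟩)
    · exact ⟨mergeInl S T a, mt mergeInl_eq_root.1 ha, hd, (hl a ha).trans hc⟩
    · exact ⟨mergeInr S T a, mt mergeInr_eq_root.1 ha,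
        (Rooting.mergeDepth_mergeInr R Q a).trans hd, (hr a ha).trans hc⟩

theorem ncard_broom_children {m k : ℕ} (a : Fin (m + k + 1)) :
    {w | w ≠ (broom m k).root ∧ (broomRooting m k).parent w = a}.ncard =
      if a.val < k then 1 else if a.val = k then m else 0 := by
  have hmem (w : Fin (m + k + 1)) :
      w ∈ {w | w ≠ (broom m k).root ∧ (broomRooting m k).parent w = a} ↔
        w.val ≠ 0 ∧ (if w.val ≤ k then w.val - 1 else k) = a.val :=
    and_congr (not_congr Fin.ext_iff) ⟨fun h => congrArg Fin.val h, fun h => Fin.ext h⟩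
  split_ifs with h1 h2
  · rw [Set.ncard_eq_one]
    refine ⟨(⟨a.val + 1, by omega⟩ : Fin (m + k + 1)), Set.ext fun (w : Fin (m + k + 1)) => ?_⟩
    refine (hmem w).trans (Iff.trans ?_ (Fin.ext_iff (a := w)).symm)
    simp only
    split_ifs <;> omega
  · trans (Set.range (pendant m k)).ncard
    · congr 1
      refine Set.ext fun (w : Fin (m + k + 1)) => ?_
      refine (hmem w).trans (Iff.trans ?_ Set.mem_range.symm)
      constructor
      · intro h
        have : k < w.val := by split_ifs at h <;> omega
        exact ⟨⟨w.val - (k + 1), by omega⟩, Fin.ext (by rw [pendant_val]; simp only; omega)⟩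
      · rintro ⟨j, rfl⟩
        rw [pendant_val]
        split_ifs <;> omega
    · rw [← Set.image_univ, Set.ncard_image_of_injective _ (pendant m k).injective, Set.ncard_univ, Nat.card_fin]
  · rw [Set.ncard_eq_zero]
    refine Set.ext fun (w : Fin (m + k + 1)) => ?_
    refine (hmem w).trans (iff_of_false ?_ (Set.notMem_empty _))
    split_ifs <;> omega

theorem forkSet_broom {m k : ℕ} (hm : 2 ≤ m) (hk : 0 < k) : forkSet (broom m k) = {(k, m)} := by
  rw [(broomRooting m k).forkSet_eq]
  ext ⟨d, e⟩
  simp only [Set.mem_ofPred_eq, Set.mem_singleton_iff, Prod.mk.injEq]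
  constructor
  · rintro ⟨he, (v : Fin (m + k + 1)), -, hd, hc⟩
    rw [ncard_broom_children] at hc
    rw [broomRooting_depth] at hd
    split_ifs at hc <;> omega
  · rintro ⟨rfl, rfl⟩
    refine ⟨hm, (⟨d, by omega⟩ : Fin (e + d + 1)), fun h => ?_, ?_, ?_⟩
    · have := Fin.ext_iff.1 h
      exact hk.ne' this
    · rw [broomRooting_depth]; simp
    · rw [ncard_broom_children]; simp

/-- The bad condition makes every handle nonempty and gives each broom at least two pendant
vertices, so each broom contributes exactly one element to `forkSet`. -/
theorem isomorphic_merge_broom_iff {m n p q m' n' p' q' : ℕ} (h : BadBrooms m p n q)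
    (h' : BadBrooms m' p' n' q') :
    Isomorphic (merge (broom m p) (broom n q)) (merge (broom m' p') (broom n' q')) ↔
      (m = m' ∧ p = p' ∧ n = n' ∧ q = q') ∨ (m = n' ∧ p = q' ∧ n = m' ∧ q = p') := by
  constructor
  · intro hiso
    have hfork := hiso.forkSet_eq ((broomRooting m p).merge (broomRooting n q)).connected
    unfold BadBrooms at h h'
    rw [forkSet_merge (broomRooting m p) (broomRooting n q),
      forkSet_merge (broomRooting m' p') (broomRooting n' q'),
      forkSet_broom (by omega) (by omega), forkSet_broom (by omega) (by omega),
      forkSet_broom (by omega) (by omega), forkSet_broom (by omega) (by omega),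
      Set.singleton_union, Set.singleton_union, Set.pair_eq_pair_iff] at hfork
    simp only [Prod.mk.injEq] at hfork
    omega
  · rintro (⟨rfl, rfl, rfl, rfl⟩ | ⟨rfl, rfl, rfl, rfl⟩)
    · exact ⟨SimpleGraph.Iso.refl, rfl⟩
    · exact merge_comm _ _

end RootedGraph

/-! ### Counting the bad pairs of brooms -/

namespace RootedGraph

/-- The number of choices of `p` for brooms `B_{s-n,p}` and `B_{n,q}`, up to exchanging the brooms
if `s = 2 * n`. -/
def handleCount (N s n : ℕ) : ℕ := if 2 * n < s then N - 2 * s else (N + 1 - 2 * s) / 2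

/-- Parameters `(s, n, t)` that represent the merges `B_{s-n,n+t} · B_{n,q}` with `N` vertices that
are not rank unimodal. -/
def badParams (N : ℕ) : Finset (Σ _ : ℕ, Σ _ : ℕ, ℕ) :=
  (Icc 5 (N / 2)).sigma fun s => (Icc 2 (s / 2)).sigma fun n => range (handleCount N s n)

/-- The isomorphism class given by a parameter, see `badParams`. -/
def badClass (N : ℕ) (x : Σ _ : ℕ, Σ _ : ℕ, ℕ) : IsoClass :=
  ⟦merge (broom (x.1 - x.2.1) (x.2.1 + x.2.2)) (broom x.2.1 (N - 1 - x.1 - x.2.1 - x.2.2))⟧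

/-- With `s = m + n`, `p = n + t` and `q = N - 1 - s - p`, the condition `m ≤ q` reads `t + 2 * s <
N`. For `m = n` the normalization `p ≤ q` sharpens it to `2 * t + 2 * s < N`. -/
theorem mem_badParams {N s n t : ℕ} : (⟨s, n, t⟩ : Σ _ : ℕ, Σ _ : ℕ, ℕ) ∈ badParams N ↔
    5 ≤ s ∧ 2 ≤ n ∧ 2 * n ≤ s ∧ t + 2 * s < N ∧ (2 * n = s → 2 * t + 2 * s < N) := by
  simp only [badParams, mem_sigma, mem_Icc, mem_range, handleCount]
  split_ifs <;> omega

theorem badBrooms_of_mem_badParams {N s n t : ℕ}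
    (h : (⟨s, n, t⟩ : Σ _ : ℕ, Σ _ : ℕ, ℕ) ∈ badParams N) :
    BadBrooms (s - n) (n + t) n (N - 1 - s - n - t) := by
  rw [mem_badParams] at h
  unfold BadBrooms
  omega

theorem badClass_injOn (N : ℕ) : Set.InjOn (badClass N) (badParams N) := by
  rintro ⟨s, n, t⟩ h ⟨s', n', t'⟩ h' heq
  rw [mem_coe] at h h'
  have hiso := (isomorphic_merge_broom_iff (badBrooms_of_mem_badParams h)
    (badBrooms_of_mem_badParams h')).1 (Quotient.exact heq)
  rw [mem_badParams] at h h'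
  obtain ⟨rfl, rfl, rfl⟩ : s = s' ∧ n = n' ∧ t = t' := by omega
  rfl

theorem mem_nonUnimodalTrees_iff {N : ℕ} {c : IsoClass} : c ∈ nonUnimodalTrees N ↔
    ∃ m n p q, BadBrooms m p n q ∧ m + n + p + q + 1 = N ∧
      c = ⟦merge (broom m p) (broom n q)⟧ := by
  constructor
  · rintro ⟨_, m, n, p, q, hm, hn, rfl, hN, hu, rfl⟩
    rw [rankUnimodal_merge_broom_iff hm hn, not_not] at hu
    rw [card_merge_broom] at hN
    exact ⟨m, n, p, q, hu, hN, rfl⟩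
  · rintro ⟨m, n, p, q, h, hN, rfl⟩
    have hm : 0 < m := by unfold BadBrooms at h; omega
    have hn : 0 < n := by unfold BadBrooms at h; omega
    refine ⟨_, m, n, p, q, hm, hn, rfl, ?_, ?_, rfl⟩
    · rw [card_merge_broom]; exact hN
    · rw [rankUnimodal_merge_broom_iff hm hn, not_not]; exact h

theorem nonUnimodalTrees_eq (N : ℕ) : nonUnimodalTrees N = badClass N '' badParams N := by
  ext c
  rw [mem_nonUnimodalTrees_iff]
  constructor
  · rintro ⟨m, n, p, q, h, hN, rfl⟩
    -- The representative of an unordered pair has the larger number of pendant vertices first, and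
    -- ties are broken by the shorter handle.
    wlog hc : n < m ∨ n = m ∧ p ≤ q generalizing m n p q
    · rw [show (⟦merge (broom m p) (broom n q)⟧ : IsoClass) = ⟦merge (broom n q) (broom m p)⟧ from
        Quotient.sound (merge_comm _ _)]
      exact this n m q p h.symm (by omega) (by omega)
    unfold BadBrooms at h
    refine ⟨⟨m + n, n, p - n⟩, mem_coe.2 (mem_badParams.2 (by omega)), ?_⟩
    simp only [badClass]
    rw [Nat.add_sub_cancel, show n + (p - n) = p by omega,
      show N - 1 - (m + n) - n - (p - n) = q by omega]
  · rintro ⟨⟨s, n, t⟩, h, rfl⟩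
    refine ⟨_, _, _, _, badBrooms_of_mem_badParams h, ?_, rfl⟩
    rw [mem_coe, mem_badParams] at h
    omega

theorem nonUnimodalCount_eq (N : ℕ) : nonUnimodalCount N = #(badParams N) := by
  rw [nonUnimodalCount, nonUnimodalTrees_eq, Set.InjOn.ncard_image (badClass_injOn N),
    Set.ncard_coe_finset]

theorem card_badParams (N : ℕ) :
    #(badParams N) = ∑ s ∈ Icc 5 (N / 2), ∑ n ∈ Icc 2 (s / 2), handleCount N s n := by
  simp only [badParams, card_sigma, card_range]

/-- The weights count the ordered pairs `(m, n)` with `m, n ≥ 2` and `m + n = s`. -/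
theorem sum_ite_two_one {s : ℕ} (hs : 5 ≤ s) :
    ∑ n ∈ Icc 2 (s / 2), (if 2 * n < s then 2 else 1) = s - 3 := by
  obtain ⟨h, rfl | rfl⟩ := Nat.even_or_odd' s
  · obtain ⟨h, rfl⟩ : ∃ i, h = i + 1 := ⟨h - 1, by omega⟩
    rw [Nat.mul_div_cancel_left _ two_pos, sum_Icc_succ_top (by omega), if_neg (lt_irrefl _),
      sum_congr rfl (g := fun _ => 2) fun n hn => if_pos (by rw [mem_Icc] at hn; omega)]
    simp only [sum_const, Nat.card_Icc, smul_eq_mul]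
    omega
  · rw [show (2 * h + 1) / 2 = h by omega,
      sum_congr rfl (g := fun _ => 2) fun n hn => if_pos (by rw [mem_Icc] at hn; omega)]
    simp only [sum_const, Nat.card_Icc, smul_eq_mul]
    omega

theorem sum_handleCount_even {K s : ℕ} (hs : 5 ≤ s) (hK : s ≤ K) :
    ∑ n ∈ Icc 2 (s / 2), handleCount (2 * K) s n = (K - s) * (s - 3) := by
  rw [← sum_ite_two_one hs, mul_sum]
  refine sum_congr rfl fun n _ => ?_
  unfold handleCount
  split_ifs <;> omega

/-- Passing from `2 * K` to `2 * K + 1` vertices adds exactly one handle choice for each of the `s /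
2 - 1` values of `n`. -/
theorem sum_handleCount_odd {K s : ℕ} (hs : 5 ≤ s) (hK : s ≤ K) :
    ∑ n ∈ Icc 2 (s / 2), handleCount (2 * K + 1) s n = (K - s) * (s - 3) + (s / 2 - 1) := by
  rw [← sum_handleCount_even hs hK, show s / 2 - 1 = ∑ n ∈ Icc 2 (s / 2), 1 by simp,
    ← sum_add_distrib]
  refine sum_congr rfl fun n _ => ?_
  unfold handleCount
  split_ifs <;> omega

theorem sum_Icc_five_eq (k : ℕ) (f : ℕ → ℕ) :
    ∑ s ∈ Icc 5 (k + 5), f s = ∑ i ∈ range (k + 1), f (i + 5) := by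
  rw [range_eq_Ico, sum_Ico_add' f 0 (k + 1) 5]
  rfl

theorem card_badParams_even (k : ℕ) :
    #(badParams (2 * k + 10)) = ∑ i ∈ range (k + 1), (k - i) * (i + 2) := by
  rw [card_badParams, show (2 * k + 10) / 2 = k + 5 by omega, ← sum_Icc_five_eq k
    (fun s => (k + 5 - s) * (s - 3))|>.trans (sum_congr rfl fun i _ => by congr 1; omega)]
  refine sum_congr rfl fun s hs => ?_
  rw [mem_Icc] at hs
  exact sum_handleCount_even (K := k + 5) hs.1 hs.2

theorem card_badParams_odd (k : ℕ) :
    #(badParams (2 * k + 11)) = #(badParams (2 * k + 10)) +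
      ∑ i ∈ range (k + 1), ((i + 5) / 2 - 1) := by
  rw [card_badParams, card_badParams, show (2 * k + 10) / 2 = k + 5 by omega,
    show (2 * k + 11) / 2 = k + 5 by omega, ← sum_Icc_five_eq k fun s => s / 2 - 1,
    ← sum_add_distrib]
  refine sum_congr rfl fun s hs => ?_
  rw [mem_Icc] at hs
  rw [show 2 * k + 10 = 2 * (k + 5) by ring, show 2 * k + 11 = 2 * (k + 5) + 1 by ring,
    sum_handleCount_odd hs.1 hs.2, sum_handleCount_even hs.1 hs.2]

theorem sum_range_half (k : ℕ) :
    ∑ i ∈ range (k + 1), ((i + 5) / 2 - 1) = (k + 1) * (k + 5) / 4 := by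
  induction k with
  | zero => rfl
  | succ k ih =>
    rw [sum_range_succ, ih]
    obtain ⟨h, rfl | rfl⟩ := Nat.even_or_odd' k
    · ring_nf; omega
    · ring_nf; omega

theorem two_mul_sum_range_add_two (k : ℕ) :
    2 * ∑ i ∈ range (k + 1), (i + 2) = (k + 1) * (k + 4) := by
  induction k with
  | zero => rfl
  | succ k ih => rw [sum_range_succ, mul_add, ih]; ring

theorem sum_range_sub_mul_add_two_succ (k : ℕ) :
    ∑ i ∈ range (k + 2), (k + 1 - i) * (i + 2) =
      ∑ i ∈ range (k + 1), (k - i) * (i + 2) + ∑ i ∈ range (k + 1), (i + 2) := by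
  rw [sum_range_succ, Nat.sub_self, zero_mul, add_zero, ← sum_add_distrib]
  refine sum_congr rfl fun i hi => ?_
  rw [mem_range] at hi
  rw [show k + 1 - i = k - i + 1 by omega]
  ring

/-- Induction on `k`: the left sum grows by `(k + 1) * (k + 4) / 2`, and the floors are resolved by
the parity of `k`. The square stays on the left to avoid truncated subtraction. -/
theorem sum_range_sub_mul_add_two (k : ℕ) :
    ∑ i ∈ range (k + 1), (k - i) * (i + 2) + k ^ 2 / 4 =
      2 * ∑ i ∈ range (k + 1), i * (i + 4) / 4 := by
  induction k with
  | zero => rfl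
  | succ k ih =>
    rw [sum_range_sub_mul_add_two_succ, sum_range_succ (fun i => i * (i + 4) / 4), mul_add, ← ih]
    have h1 := two_mul_sum_range_add_two k
    have h2 : 2 * ((k + 1) * (k + 1 + 4) / 4) + k ^ 2 / 4 =
        ∑ i ∈ range (k + 1), (i + 2) + (k + 1) ^ 2 / 4 := by
      obtain ⟨h, rfl | rfl⟩ := Nat.even_or_odd' k
      · ring_nf at h1 ⊢; omega
      · ring_nf at h1 ⊢; omega
    omega

end RootedGraph

open RootedGraph

/-- Finiteness is part of the claim because `Set.ncard` is 0 on infinite sets; without it the counts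
would not carry their meaning. -/
theorem theorem2 :
    (∀ i : ℕ, (nonUnimodalTrees i).Finite) ∧
    (∀ i : ℕ, 1 ≤ i → i ≤ 9 → nonUnimodalCount i = 0) ∧
    (∀ k : ℕ,
      (nonUnimodalCount (2 * k + 10) : ℤ) =
        2 * (∑ i ∈ Finset.range (k + 1), ((i * (i + 4) / 4 : ℕ) : ℤ)) - ((k ^ 2 / 4 : ℕ) : ℤ)) ∧
    (∀ k : ℕ,
      (nonUnimodalCount (2 * k + 11) : ℤ) =
        2 * (∑ i ∈ Finset.range (k + 1), ((i * (i + 4) / 4 : ℕ) : ℤ))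
          + (((k + 1) * (k + 5) / 4 : ℕ) : ℤ) - ((k ^ 2 / 4 : ℕ) : ℤ)) := by
  refine ⟨fun i => ?_, fun i _ hi => ?_, fun k => ?_, fun k => ?_⟩
  · rw [nonUnimodalTrees_eq]
    exact (badParams i).finite_toSet.image _
  · rw [nonUnimodalCount_eq, card_badParams, Icc_eq_empty (by omega), sum_empty]
  · have h := sum_range_sub_mul_add_two k
    rw [← card_badParams_even, ← nonUnimodalCount_eq] at h
    rw [← Nat.cast_sum]
    omega
  · have h := sum_range_sub_mul_add_two k
    have h' := card_badParams_odd k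
    rw [sum_range_half] at h'
    rw [← card_badParams_even] at h
    rw [nonUnimodalCount_eq, ← Nat.cast_sum]
    omega
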